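/- All graphs are finite, simple and undirected. A greyscale of a graph $G=(V,E)$ is a map $f:V\to[0,1]$ that attains both values $0$ and $1$ (the extreme tones). Its gradation vector is the list of the numbers $|f(u)-f(v)|$, $\{u,v\}\in E$, in decreasing order; gradation vectors are compared lexicographically. An incomplete greyscale is a map $g:V_c\to[0,1]$ on a nonempty proper subset $V_c$ of $V$, and a greyscale $f$ is compatible with $g$ if $f(u)=g(u)$ for all $u\in V_c$. A minimum gradation greyscale in a set of greyscales is one whose gradation vector is the least among those of the members of the set. Theorem. (1) There are a program for the real random access machine (unit cost for each memory access, each comparison, each addition and truncated subtraction of indices, and each arithmetic operation $+,-,\cdot,/$ on real numbers) and a constant $C$ such that the following holds. Let $G$ be a connected graph with vertices $0,\dots,n-1$ and let $g$ be an incomplete greyscale of $G$ that attains exactly one of the extreme tones $0$ and $1$. Given $G$ (by its adjacency matrix) and $g$, the program halts after at most $C\,n^5$ steps and outputs a list of colourings which consists precisely of all minimum gradation greyscales among the greyscales of $G$ compatible with $g$. Thus these greyscales are found in polynomial time, $O(n^5)$. (2) Let $g$ be an incomplete $V_c$-greyscale of a connected graph $G=(V,E)$ that attains exactly one extreme tone,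 and let $c\in\{0,1\}$ be the other one. For every $w\in V\setminus V_c$ there is exactly one minimum gradation greyscale $f_w$ among the greyscales $f$ compatible with $g$ such that $f(w)=c$. The minimum gradation greyscales among all greyscales compatible with $g$ are exactly those $f_w$, $w\in V\setminus V_c$, whose gradation vector is the least among the gradation vectors of all $f_{w'}$, $w'\in V\setminus V_c$. -/

import Mathlib

section Greyscales

/-- A greyscale: a map from the vertices to `[0,1]` attaining both extreme tones `0` and `1`. -/
def IsGreyscale {V : Type*} (f : V → ℝ) : Prop :=
  (∀ v, f v ∈ Set.Icc (0 : ℝ) 1) ∧ (∃ v, f v = 0) ∧ (∃ v, f v = 1)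

/-- An incomplete greyscale is a partial map `g`, where `g v = none` means that `v` is not
coloured.  Its domain `V_c` is nonempty and proper, and its values lie in `[0,1]`. -/
def IsIncompleteGreyscale {V : Type*} (g : V → Option ℝ) : Prop :=
  (∃ v, g v ≠ none) ∧ (∃ v, g v = none) ∧ ∀ v x, g v = some x → x ∈ Set.Icc (0 : ℝ) 1

/-- The greyscales `f` compatible with `g`: they agree with `g` on the domain of `g`. -/
def compatibleGreyscales {V : Type*} (g : V → Option ℝ) : Set (V → ℝ) :=
  {f | IsGreyscale f ∧ ∀ v x, g v = some x → f v = x}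

/-- The tone `|f u - f v|` of the edge `{u, v}`. -/
def edgeTone {V : Type*} (f : V → ℝ) : Sym2 V → ℝ :=
  Sym2.lift ⟨fun u v => |f u - f v|, fun u v => abs_sub_comm (f u) (f v)⟩

open Classical in
/-- The gradation vector: the tones of all edges, in decreasing order.  Such lists are compared
below by the order `≤` of `List ℝ`, which is the lexicographical order. -/
noncomputable def gradation {V : Type*} [Fintype V] (G : SimpleGraph V) (f : V → ℝ) : List ℝ :=
  (G.edgeFinset.val.map (edgeTone f)).sort (· ≥ ·)

/-- `f` belongs to `S` and has the least gradation vector among the members of `S`. -/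
def IsMinGradation {V : Type*} [Fintype V] (G : SimpleGraph V) (S : Set (V → ℝ))
    (f : V → ℝ) : Prop :=
  f ∈ S ∧ ∀ f' ∈ S, gradation G f ≤ gradation G f'

end Greyscales

/-! ## A real random access machine

Programs are finite syntax trees; they work on natural numbers (indices), with addition,
truncated subtraction and comparison, and on real numbers, with the four arithmetic operations
and comparison.  There are variables of both kinds and, for each array name, a two-dimensional
array.  Every elementary operation, memory access, test and assignment costs one time unit. -/

namespace RealRAM

/-- The memory of the machine. -/
structure State where
  idxVar : ℕ → ℕ
  realVar : ℕ → ℝ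
  idxArr : ℕ → ℕ → ℕ → ℕ
  realArr : ℕ → ℕ → ℕ → ℝ

/-- Expressions for indices. -/
inductive IdxExpr where
  | lit (k : ℕ)
  | var (x : ℕ)
  | get (a : ℕ) (i j : IdxExpr)
  | add (e₁ e₂ : IdxExpr)
  | sub (e₁ e₂ : IdxExpr)

/-- Expressions for real numbers; the only constants are natural numbers. -/
inductive RealExpr where
  | lit (k : ℕ)
  | var (x : ℕ)
  | get (a : ℕ) (i j : IdxExpr)
  | ofIdx (e : IdxExpr)
  | add (e₁ e₂ : RealExpr)
  | sub (e₁ e₂ : RealExpr)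
  | mul (e₁ e₂ : RealExpr)
  | div (e₁ e₂ : RealExpr)

/-- Tests. -/
inductive Test where
  | idxLe (e₁ e₂ : IdxExpr)
  | realLe (e₁ e₂ : RealExpr)
  | not (b : Test)
  | and (b₁ b₂ : Test)

/-- Programs. -/
inductive Program where
  | skip
  | setIdx (x : ℕ) (e : IdxExpr)
  | setReal (x : ℕ) (e : RealExpr)
  | storeIdx (a : ℕ) (i j : IdxExpr) (e : IdxExpr)
  | storeReal (a : ℕ) (i j : IdxExpr) (e : RealExpr)
  | seq (p q : Program)
  | ite (b : Test) (p q : Program)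
  | loop (b : Test) (p : Program)

/-- The value of an index expression. -/
def IdxExpr.eval (s : State) : IdxExpr → ℕ
  | .lit k => k
  | .var x => s.idxVar x
  | .get a i j => s.idxArr a (i.eval s) (j.eval s)
  | .add e₁ e₂ => e₁.eval s + e₂.eval s
  | .sub e₁ e₂ => e₁.eval s - e₂.eval s

/-- The number of operations needed to evaluate an index expression. -/
def IdxExpr.cost : IdxExpr → ℕ
  | .lit _ => 1
  | .var _ => 1
  | .get _ i j => i.cost + j.cost + 1
  | .add e₁ e₂ => e₁.cost + e₂.cost + 1
  | .sub e₁ e₂ => e₁.cost + e₂.cost + 1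

/-- The value of a real expression (a quotient with denominator `0` has the value `0`). -/
noncomputable def RealExpr.eval (s : State) : RealExpr → ℝ
  | .lit k => (k : ℝ)
  | .var x => s.realVar x
  | .get a i j => s.realArr a (i.eval s) (j.eval s)
  | .ofIdx e => (e.eval s : ℝ)
  | .add e₁ e₂ => e₁.eval s + e₂.eval s
  | .sub e₁ e₂ => e₁.eval s - e₂.eval s
  | .mul e₁ e₂ => e₁.eval s * e₂.eval s
  | .div e₁ e₂ => e₁.eval s / e₂.eval s

/-- The number of operations needed to evaluate a real expression. -/
def RealExpr.cost : RealExpr → ℕ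
  | .lit _ => 1
  | .var _ => 1
  | .get _ i j => i.cost + j.cost + 1
  | .ofIdx e => e.cost + 1
  | .add e₁ e₂ => e₁.cost + e₂.cost + 1
  | .sub e₁ e₂ => e₁.cost + e₂.cost + 1
  | .mul e₁ e₂ => e₁.cost + e₂.cost + 1
  | .div e₁ e₂ => e₁.cost + e₂.cost + 1

/-- The outcome of a test. -/
def Test.Holds (s : State) : Test → Prop
  | .idxLe e₁ e₂ => e₁.eval s ≤ e₂.eval s
  | .realLe e₁ e₂ => e₁.eval s ≤ e₂.eval s
  | .not b => ¬ b.Holds s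
  | .and b₁ b₂ => b₁.Holds s ∧ b₂.Holds s

/-- The number of operations needed to evaluate a test. -/
def Test.cost : Test → ℕ
  | .idxLe e₁ e₂ => e₁.cost + e₂.cost + 1
  | .realLe e₁ e₂ => e₁.cost + e₂.cost + 1
  | .not b => b.cost + 1
  | .and b₁ b₂ => b₁.cost + b₂.cost + 1

/-- Replace the entry `(i, j)` of the array named `a` by `x`. -/
def updateArr {α : Type} (A : ℕ → ℕ → ℕ → α) (a i j : ℕ) (x : α) : ℕ → ℕ → ℕ → α :=
  fun a' i' j' => if a' = a ∧ i' = i ∧ j' = j then x else A a' i' j'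

/-- `Runs p s t s'`: started in the state `s`, the program `p` halts after exactly `t` time
units in the state `s'`. -/
inductive Runs : Program → State → ℕ → State → Prop where
  | skip (s : State) : Runs .skip s 1 s
  | setIdx (s : State) (x : ℕ) (e : IdxExpr) :
      Runs (.setIdx x e) s (e.cost + 1)
        { s with idxVar := Function.update s.idxVar x (e.eval s) }
  | setReal (s : State) (x : ℕ) (e : RealExpr) :
      Runs (.setReal x e) s (e.cost + 1)
        { s with realVar := Function.update s.realVar x (e.eval s) }
  | storeIdx (s : State) (a : ℕ) (i j : IdxExpr) (e : IdxExpr) :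
      Runs (.storeIdx a i j e) s (i.cost + j.cost + e.cost + 1)
        { s with idxArr := updateArr s.idxArr a (i.eval s) (j.eval s) (e.eval s) }
  | storeReal (s : State) (a : ℕ) (i j : IdxExpr) (e : RealExpr) :
      Runs (.storeReal a i j e) s (i.cost + j.cost + e.cost + 1)
        { s with realArr := updateArr s.realArr a (i.eval s) (j.eval s) (e.eval s) }
  | seq {p q : Program} {s s' s'' : State} {t t' : ℕ} :
      Runs p s t s' → Runs q s' t' s'' → Runs (.seq p q) s (t + t') s''
  | iteTrue {b : Test} {p q : Program} {s s' : State} {t : ℕ} :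
      b.Holds s → Runs p s t s' → Runs (.ite b p q) s (b.cost + 1 + t) s'
  | iteFalse {b : Test} {p q : Program} {s s' : State} {t : ℕ} :
      ¬ b.Holds s → Runs q s t s' → Runs (.ite b p q) s (b.cost + 1 + t) s'
  | loopDone {b : Test} {p : Program} {s : State} :
      ¬ b.Holds s → Runs (.loop b p) s (b.cost + 1) s
  | loopStep {b : Test} {p : Program} {s s' s'' : State} {t t' : ℕ} :
      b.Holds s → Runs p s t s' → Runs (.loop b p) s' t' s'' →
      Runs (.loop b p) s (b.cost + 1 + t + t') s''

/-- The machine is deterministic: running time and final state are determined by the program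
and the initial state. -/
theorem Runs.deterministic {p : Program} {s s₁ s₂ : State} {t₁ t₂ : ℕ}
    (h₁ : Runs p s t₁ s₁) (h₂ : Runs p s t₂ s₂) : t₁ = t₂ ∧ s₁ = s₂ := by
  induction h₁ generalizing t₂ s₂ with
  | skip => cases h₂; exact ⟨rfl, rfl⟩
  | setIdx => cases h₂; exact ⟨rfl, rfl⟩
  | setReal => cases h₂; exact ⟨rfl, rfl⟩
  | storeIdx => cases h₂; exact ⟨rfl, rfl⟩
  | storeReal => cases h₂; exact ⟨rfl, rfl⟩
  | seq _ _ ih ih' =>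
    cases h₂ with
    | seq k k' =>
      obtain ⟨rfl, rfl⟩ := ih k
      obtain ⟨rfl, rfl⟩ := ih' k'
      exact ⟨rfl, rfl⟩
  | iteTrue hb _ ih =>
    cases h₂ with
    | iteTrue _ k => obtain ⟨rfl, rfl⟩ := ih k; exact ⟨rfl, rfl⟩
    | iteFalse hb' _ => exact absurd hb hb'
  | iteFalse hb _ ih =>
    cases h₂ with
    | iteTrue hb' _ => exact absurd hb' hb
    | iteFalse _ k => obtain ⟨rfl, rfl⟩ := ih k; exact ⟨rfl, rfl⟩
  | loopDone hb =>
    cases h₂ with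
    | loopDone _ => exact ⟨rfl, rfl⟩
    | loopStep hb' _ _ => exact absurd hb' hb
  | loopStep hb _ _ ih ih' =>
    cases h₂ with
    | loopDone hb' => exact absurd hb hb'
    | loopStep _ k k' =>
      obtain ⟨rfl, rfl⟩ := ih k
      obtain ⟨rfl, rfl⟩ := ih' k'
      exact ⟨rfl, rfl⟩

open Classical in
/-- The initial state for a graph `G` on the vertices `0, …, n-1` and a partial colouring `g`.
Index variable `0` holds `n`; index array `0` holds the adjacency matrix of `G`; index array `1`
holds at `(i, 0)` whether the vertex `i` is coloured (`1`) or not (`0`), and real array `0` holds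
at `(i, 0)` the tone of `i` if it is coloured.  All other memory cells are `0`. -/
noncomputable def input {n : ℕ} (G : SimpleGraph (Fin n)) (g : Fin n → Option ℝ) : State where
  idxVar x := if x = 0 then n else 0
  realVar _ := 0
  idxArr a i j :=
    if a = 0 then
      if ∃ (hi : i < n) (hj : j < n), G.Adj ⟨i, hi⟩ ⟨j, hj⟩ then 1 else 0
    else if a = 1 then
      if ∃ hi : i < n, j = 0 ∧ g ⟨i, hi⟩ ≠ none then 1 else 0
    else 0
  realArr a i j :=
    if h : a = 0 ∧ i < n ∧ j = 0 then (g ⟨i, h.2.1⟩).getD 0 else 0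

/-- The vertex colourings listed in the memory: index variable `1` holds their number, and the
`k`-th of them is the `k`-th row of real array `1`. -/
def output (n : ℕ) (s : State) : Set (Fin n → ℝ) :=
  {f | ∃ k < s.idxVar 1, ∀ i : Fin n, f i = s.realArr 1 k i}

end RealRAM

/-! ## Comparison of gradation vectors by the multiplicities of the tones -/

/-! Fix a nonempty coloured set `D` with tones `f`. From a vertex outside `D` take two walks that
meet `D` only in their ends `u` and `u'` (`IsExit`); the slope of the pair is `f u - f u'` divided
by the total length. Let `s` be the largest slope, attained by a pair starting at `v`, and let `y`
be the tone of `v` by linear interpolation. If an extension of `f` gives `v` another tone, then some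
edge not contained in `D` has tone above `s`, since otherwise the bounds along the two walks pin the
tone of `v` to `y` (`IsExit.abs_sub_le`). Conversely, giving `v` the tone `y` creates no slope above
`s` (`SlopeLE.insert`), so colouring greedily in this way keeps all edges outside `D` at tones at
most `s`. Comparing the highest tones (`gradation_lt_of_tone_lt`) shows that `y` is forced in a best
extension. `IsBest.of_insert` is the induction step, and `exists_isBest` yields the best extension,
unique by the strict inequality in `IsBest`.

A compatible greyscale has the missing tone `c` at some uncoloured `w`. The best extension after
giving `c` to `w` is `solution`, and the global minima are the best among these
(`isMinGradation_iff_exists_solution`).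

The program finds steepest walks from two tables made by dynamic programming: the highest tone, and
the highest value of one minus the tone, at the ends of exit walks of length at most `k` from `x`.
Searching all vertices and pairs of lengths takes `n ^ 3` steps; there are `n` rounds for each `w`.
Gradation vectors are compared without sorting: the highest tone with different multiplicities
decides (`gradation_of_compare`). Counting each edge tone takes `n ^ 4` steps for each `w`. Both
contributions are `O(n ^ 5)`.

The program is written as `Code`, whose loops all make `n` iterations. The nesting depth then bounds
the exponent (`exists_cost_le`, `exists_runs`), and correctness is proved for the function `run` by
induction along loops. -/

theorem List.lt_of_count_lt {α : Type*} [LinearOrder α] {t : α} :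
    ∀ {l l' : List α}, l.Pairwise (· ≥ ·) → l'.Pairwise (· ≥ ·) →
      l.count t < l'.count t → (∀ τ, t < τ → l.count τ = l'.count τ) → l < l'
  | _, [], _, _, h, _ => by simp at h
  | [], b :: l', _, _, _, _ => List.nil_lt_cons b l'
  | a :: l, b :: l', hl, hl', h, heq => by
    rw [List.pairwise_cons] at hl hl'
    -- The second list contains `t`, and its head is its largest entry.
    have ht : t ≤ b := by
      have : t ∈ b :: l' := List.count_pos_iff.1 (by omega)
      rcases List.mem_cons.1 this with rfl | hm
      · exact le_rfl
      · exact hl'.1 t hm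
    rw [List.cons_lt_cons_iff]
    rcases lt_trichotomy a b with hab | rfl | hab
    · exact Or.inl hab
    · refine Or.inr ⟨rfl, List.lt_of_count_lt hl.2 hl'.2 (t := t) ?_ fun τ hτ => ?_⟩
      · simp only [List.count_cons] at h
        omega
      · have := heq τ hτ
        simp only [List.count_cons] at this
        omega
    -- Here `a` exceeds `b`, hence also `t`, so it occurs equally often in both lists; but nothing
    -- in the second list exceeds `b`.
    · exfalso
      have h1 := heq a (ht.trans_lt hab)
      have h2 : a ∈ b :: l' := List.count_pos_iff.1 (by rw [← h1]; simp)
      rcases List.mem_cons.1 h2 with rfl | hm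
      · exact lt_irrefl _ hab
      · exact absurd (hl'.1 a hm) (not_le.2 hab)

namespace Greyscale

open Classical in
/-- The number of ordered pairs of adjacent vertices with tone `t`. -/
noncomputable def toneCount {V : Type*} [Fintype V] (G : SimpleGraph V) (f : V → ℝ) (t : ℝ) : ℕ :=
  (Finset.univ.filter fun p : V × V => G.Adj p.1 p.2 ∧ |f p.1 - f p.2| = t).card

section

variable {V : Type*} [Fintype V] (G : SimpleGraph V)

open Classical in
theorem toneCount_eq (f : V → ℝ) (t : ℝ) :
    toneCount G f t = 2 * (gradation G f).count t := by
  have h1 : (gradation G f).count t = (G.edgeFinset.filter fun e => t = edgeTone f e).card := by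
    rw [← Multiset.coe_count, gradation, Multiset.sort_eq, Multiset.count_map]
    rfl
  rw [h1, toneCount, mul_comm]
  have h2 : ∀ p ∈ Finset.univ.filter fun p : V × V => G.Adj p.1 p.2 ∧ |f p.1 - f p.2| = t,
      s(p.1, p.2) ∈ G.edgeFinset.filter fun e => t = edgeTone f e := by
    intro p hp
    rw [Finset.mem_filter] at hp
    rw [Finset.mem_filter, SimpleGraph.mem_edgeFinset]
    exact ⟨hp.2.1, hp.2.2.symm⟩
  -- The ordered pairs are counted by their underlying edges; every fibre consists of the two
  -- orientations.
  rw [Finset.card_eq_sum_card_fiberwise (f := fun p : V × V => s(p.1, p.2)) h2,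
    Finset.sum_const_nat]
  intro e he
  induction e using Sym2.ind with
  | _ u v =>
    rw [Finset.mem_filter, SimpleGraph.mem_edgeFinset] at he
    obtain ⟨hadj : G.Adj u v, htone : t = |f u - f v|⟩ := he
    have : (((Finset.univ.filter fun p : V × V => G.Adj p.1 p.2 ∧ |f p.1 - f p.2| = t)).filter
        fun p => s(p.1, p.2) = s(u, v)) = {(u, v), (v, u)} := by
      ext ⟨a, b⟩
      simp only [Finset.mem_filter, Finset.mem_univ, true_and, Sym2.eq_iff, Finset.mem_insert,
        Finset.mem_singleton, Prod.mk.injEq]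
      constructor
      · exact fun h => h.2
      · rintro (⟨rfl, rfl⟩ | ⟨rfl, rfl⟩)
        · exact ⟨⟨hadj, htone.symm⟩, Or.inl ⟨rfl, rfl⟩⟩
        · exact ⟨⟨hadj.symm, by rw [abs_sub_comm, htone]⟩, Or.inr ⟨rfl, rfl⟩⟩
    rw [this, Finset.card_pair]
    simp [hadj.ne]

theorem gradation_pairwise (f : V → ℝ) : (gradation G f).Pairwise (· ≥ ·) :=
  Multiset.pairwise_sort _ _

theorem gradation_lt_of_toneCount {f f' : V → ℝ} {t : ℝ}
    (h : toneCount G f t < toneCount G f' t)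
    (heq : ∀ τ, t < τ → toneCount G f τ = toneCount G f' τ) : gradation G f < gradation G f' := by
  simp only [toneCount_eq] at h heq
  exact List.lt_of_count_lt (gradation_pairwise G f) (gradation_pairwise G f') (t := t)
    (by omega) fun τ hτ => by have := heq τ hτ; omega

theorem gradation_eq_of_toneCount {f f' : V → ℝ}
    (heq : ∀ τ, toneCount G f τ = toneCount G f' τ) : gradation G f = gradation G f' := by
  simp only [toneCount_eq] at heq
  refine List.Perm.eq_of_pairwise (fun a b _ _ h h' => le_antisymm h' h)
    (gradation_pairwise G f) (gradation_pairwise G f') ?_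
  rw [List.perm_iff_count]
  intro τ
  have := heq τ
  omega

/-- If two colourings agree on `D`, the tones of the other edges are at most `s` for the first one
and exceed `s` somewhere for the second one, then the first one has the smaller gradation. -/
theorem gradation_lt_of_tone_lt {D : Set V} {f f' : V → ℝ} {s : ℝ} (hD : ∀ v ∈ D, f' v = f v)
    (hle : ∀ x y, G.Adj x y → x ∉ D → |f x - f y| ≤ s)
    (hlt : ∃ x y, G.Adj x y ∧ x ∉ D ∧ s < |f' x - f' y|) : gradation G f < gradation G f' := by
  classical
  obtain ⟨x₀, y₀, hxy, hx₀, hs⟩ := hlt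
  -- The deciding tone is the highest one that `f'` has on an edge not contained in `D`.
  obtain ⟨⟨x, y⟩, hm, hmax⟩ := Finset.exists_max_image
    (Finset.univ.filter fun p : V × V => G.Adj p.1 p.2 ∧ p.1 ∉ D) (fun p => |f' p.1 - f' p.2|)
    ⟨(x₀, y₀), by simp [hxy, hx₀]⟩
  simp only [Finset.mem_filter, Finset.mem_univ, true_and, Prod.forall] at hm hmax
  have hst : s < |f' x - f' y| := hs.trans_le (hmax x₀ y₀ ⟨hxy, hx₀⟩)
  -- Above `s` the colouring `f` has tones only on edges inside `D`, where both colourings agree.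
  have key : ∀ a b τ, s < τ → G.Adj a b → |f a - f b| = τ → |f' a - f' b| = τ := by
    intro a b τ hτ hab h
    by_cases ha : a ∈ D
    · by_cases hb : b ∈ D
      · rw [hD a ha, hD b hb, h]
      · have := hle b a hab.symm hb
        rw [abs_sub_comm, h] at this
        exact absurd this (not_le.2 hτ)
    · have := hle a b hab ha
      rw [h] at this
      exact absurd this (not_le.2 hτ)
  apply gradation_lt_of_toneCount G (t := |f' x - f' y|)
  · apply Finset.card_lt_card
    rw [Finset.ssubset_iff_of_subset]
    · refine ⟨(x, y), by simp [hm.1], ?_⟩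
      simp only [Finset.mem_filter, Finset.mem_univ, true_and, not_and]
      intro _ h
      exact absurd (hle x y hm.1 hm.2) (by rw [h]; exact not_le.2 hst)
    · intro p hp
      simp only [Finset.mem_filter, Finset.mem_univ, true_and] at hp ⊢
      exact ⟨hp.1, key _ _ _ hst hp.1 hp.2⟩
  · intro τ hτ
    unfold toneCount
    congr 1
    ext ⟨a, b⟩
    simp only [Finset.mem_filter, Finset.mem_univ, true_and]
    refine and_congr_right fun hab => ⟨key _ _ _ (hst.trans hτ) hab, fun h => ?_⟩
    by_cases ha : a ∈ D
    · by_cases hb : b ∈ D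
      · rw [← hD a ha, ← hD b hb, h]
      · have := hmax b a ⟨hab.symm, hb⟩
        rw [abs_sub_comm, h] at this
        exact absurd this (not_le.2 hτ)
    · have := hmax a b ⟨hab, ha⟩
      rw [h] at this
      exact absurd this (not_le.2 hτ)

end

/-! ## Steepest paths -/

section

variable {V : Type*} (G : SimpleGraph V)

/-- The walk `p` ends in `D` and meets `D` only in its end. -/
def IsExit {G : SimpleGraph V} (D : Set V) {x u : V} (p : G.Walk x u) : Prop :=
  u ∈ D ∧ ∀ z ∈ p.support, z ∈ D → z = u

/-- All walks with ends in `D` and a vertex outside of `D` inside have slope at most `s`. -/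
def SlopeLE (D : Set V) (f : V → ℝ) (s : ℝ) : Prop :=
  ∀ ⦃x u u' : V⦄ (p : G.Walk x u) (q : G.Walk x u'), x ∉ D → IsExit D p → IsExit D q →
    f u - f u' ≤ s * (p.length + q.length)

/-- The vertex `v` lies on a walk of maximum slope, whose linear interpolation gives `v` the
tone `y`. -/
def IsSteepest (D : Set V) (f : V → ℝ) (v : V) (y : ℝ) : Prop :=
  v ∉ D ∧ ∃ s, SlopeLE G D f s ∧ ∃ (u u' : V) (p : G.Walk v u) (q : G.Walk v u'),
    IsExit D p ∧ IsExit D q ∧ f u = y + s * p.length ∧ f u' = y - s * q.length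

variable {G} {D : Set V}

theorem IsExit.nil {u : V} (h : u ∈ D) : IsExit D (.nil : G.Walk u u) :=
  ⟨h, by simp⟩

theorem IsExit.cons {x y u : V} (h : G.Adj x y) (hx : x ∉ D) {p : G.Walk y u} (hp : IsExit D p) :
    IsExit D (.cons h p) := by
  refine ⟨hp.1, fun z hz hzD => ?_⟩
  rw [SimpleGraph.Walk.support_cons, List.mem_cons] at hz
  rcases hz with rfl | hz
  · exact absurd hzD hx
  · exact hp.2 z hz hzD

theorem IsExit.of_cons {x y u : V} {h : G.Adj x y} {p : G.Walk y u}
    (hp : IsExit D (.cons h p)) : IsExit D p :=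
  ⟨hp.1, fun z hz => hp.2 z (by rw [SimpleGraph.Walk.support_cons]; exact List.mem_cons_of_mem _ hz)⟩

theorem IsExit.length_pos {x u : V} {p : G.Walk x u} (hp : IsExit D p) (hx : x ∉ D) :
    0 < p.length := by
  cases p with
  | nil => exact absurd hp.1 hx
  | cons => simp

/-- Cut the walk at its first vertex in `D`. -/
theorem exists_isExit_of_walk {d x : V} (p : G.Walk x d) (hd : d ∈ D) :
    ∃ (u : V) (q : G.Walk x u), IsExit D q := by
  induction p with
  | nil => exact ⟨_, .nil, .nil hd⟩
  | @cons x y _ h _ ih =>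
    by_cases hx : x ∈ D
    · exact ⟨_, .nil, .nil hx⟩
    · obtain ⟨u, q, hq⟩ := ih hd
      exact ⟨u, .cons h q, hq.cons h hx⟩

theorem exists_isExit (hG : G.Connected) (hD : D.Nonempty) (x : V) :
    ∃ (u : V) (q : G.Walk x u), IsExit D q := by
  obtain ⟨d, hd⟩ := hD
  obtain ⟨p⟩ := hG.preconnected x d
  exact exists_isExit_of_walk p hd

/-- Removing cycles does not add vertices, so an exit walk stays one. Thus only finitely many
lengths matter for the maximum slope. -/
theorem IsExit.exists_short [Fintype V] {x u : V} {p : G.Walk x u} (hp : IsExit D p) :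
    ∃ q : G.Walk x u, IsExit D q ∧ q.length ≤ p.length ∧ q.length < Fintype.card V := by
  classical
  exact ⟨p.bypass, ⟨hp.1, fun z hz => hp.2 z (p.support_bypass_subset_support hz)⟩,
    p.length_bypass_le_length, p.bypass_isPath.length_lt⟩

/-- The definition admits the same walk twice, with slope zero. -/
theorem SlopeLE.nonneg {f : V → ℝ} {s : ℝ} (h : SlopeLE G D f s) {x u : V} {p : G.Walk x u}
    (hp : IsExit D p) (hx : x ∉ D) : 0 ≤ s := by
  have h1 := h p p hx hp hp
  have h2 : (0 : ℝ) < p.length := by exact_mod_cast hp.length_pos hx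
  rw [sub_self] at h1
  by_contra hs
  nlinarith

theorem SlopeLE.congr {f f' : V → ℝ} {s : ℝ} (h : SlopeLE G D f s) (hf : ∀ v ∈ D, f' v = f v) :
    SlopeLE G D f' s := fun x u u' p q hx hp hq => by
  rw [hf u hp.1, hf u' hq.1]
  exact h p q hx hp hq

theorem IsSteepest.congr {f f' : V → ℝ} {v : V} {y : ℝ} (h : IsSteepest G D f v y)
    (hf : ∀ v ∈ D, f' v = f v) : IsSteepest G D f' v y := by
  obtain ⟨hv, s, hs, u, u', p, q, hp, hq, hu, hu'⟩ := h
  exact ⟨hv, s, hs.congr hf, u, u', p, q, hp, hq, by rw [hf u hp.1, hu], by rw [hf u' hq.1, hu']⟩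

/-- A new walk ending in `v` avoids `D`. Reversed and continued by its partner it leads from `v` to
`D`, and paired with `p₀` or `q₀` it is covered by the old bound; subtracting the interpolated piece
leaves the bound for the new pair. -/
theorem SlopeLE.insert {f : V → ℝ} {s : ℝ} (h : SlopeLE G D f s) {v u₀ u₁ : V} (hv : v ∉ D)
    {p₀ : G.Walk v u₀} {q₀ : G.Walk v u₁} (hp₀ : IsExit D p₀) (hq₀ : IsExit D q₀)
    (hu₀ : f u₀ = f v + s * p₀.length) (hu₁ : f u₁ = f v - s * q₀.length) :
    SlopeLE G (Insert.insert v D) f s := by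
  intro x u u' p q hx hp hq
  have hs := h.nonneg hp₀ hv
  have hxD : x ∉ D := fun h' => hx (Set.mem_insert_of_mem _ h')
  have old : ∀ {u : V} {p : G.Walk x u}, IsExit (Insert.insert v D) p → u ≠ v → IsExit D p :=
    fun hp hu => ⟨Set.mem_of_mem_insert_of_ne hp.1 hu,
      fun z hz hzD => hp.2 z hz (Set.mem_insert_of_mem _ hzD)⟩
  have new : ∀ {u' : V} {p : G.Walk x v} {q : G.Walk x u'}, IsExit (Insert.insert v D) p →
      IsExit D q → IsExit D (p.reverse.append q) := by
    intro u' p q hp hq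
    refine ⟨hq.1, fun z hz hzD => ?_⟩
    rw [SimpleGraph.Walk.mem_support_append_iff, SimpleGraph.Walk.support_reverse,
      List.mem_reverse] at hz
    rcases hz with hz | hz
    · exact absurd (hp.2 z hz (Set.mem_insert_of_mem _ hzD) ▸ hzD) hv
    · exact hq.2 z hz hzD
  by_cases hu : u = v
  · subst hu
    by_cases hu' : u' = u
    · subst hu'
      rw [sub_self]
      positivity
    · have := h p₀ (p.reverse.append q) hv hp₀ (new hp (old hq hu'))
      rw [SimpleGraph.Walk.length_append, SimpleGraph.Walk.length_reverse] at this
      push_cast at this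
      linarith
  · by_cases hu' : u' = v
    · subst hu'
      have := h (q.reverse.append p) q₀ hv (new hq (old hp hu)) hq₀
      rw [SimpleGraph.Walk.length_append, SimpleGraph.Walk.length_reverse] at this
      push_cast at this
      linarith
    · exact h p q hxD (old hp hu) (old hq hu')

/-- Triangle inequality along the walk: it leaves a vertex outside `D` at every step before it
reaches its end. -/
theorem IsExit.abs_sub_le {f : V → ℝ} {s : ℝ} (hs : 0 ≤ s)
    (hf : ∀ a b, G.Adj a b → a ∉ D → |f a - f b| ≤ s) {x u : V} (p : G.Walk x u)
    (hp : IsExit D p) : |f x - f u| ≤ s * p.length := by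
  induction p with
  | nil => simp
  | @cons x y u h p ih =>
    -- A walk that starts in `D` may be longer than zero here, but then its two ends coincide.
    by_cases hx : x ∈ D
    · have : f x = f u := congrArg f (hp.2 x (by simp) hx)
      rw [this, sub_self, abs_zero]
      positivity
    · have h1 := ih hp.of_cons
      have h2 := hf x y h hx
      have h3 := _root_.abs_sub_le (f x) (f y) (f u)
      rw [SimpleGraph.Walk.length_cons]
      push_cast
      linarith

/-- As the slope is nonnegative, the interpolated tone lies between the tones of the two ends. -/
theorem IsSteepest.mem_Icc {D : Set V} {f : V → ℝ} (hf : ∀ v ∈ D, f v ∈ Set.Icc (0 : ℝ) 1) {v : V}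
    {y : ℝ} (h : IsSteepest G D f v y) : y ∈ Set.Icc (0 : ℝ) 1 := by
  obtain ⟨hv, s, hs, u, u', p, q, hp, hq, hu, hu'⟩ := h
  have h0 := hs.nonneg hp hv
  have h1 := hf u hp.1
  have h2 := hf u' hq.1
  have h3 : 0 ≤ s * (p.length : ℝ) := by positivity
  have h4 : 0 ≤ s * (q.length : ℝ) := by positivity
  rw [Set.mem_Icc] at *
  constructor <;> linarith

/-- Steepness depends only on the tones in `D`, so it passes to any extension that takes the
interpolated tone at `v`. This is the form in which `IsBest.of_insert` needs it. -/
theorem IsSteepest.congr_update [DecidableEq V] {D : Set V} {f : V → ℝ} {v : V} {y : ℝ}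
    (h : IsSteepest G D f v y) {f' : V → ℝ}
    (hf' : ∀ z ∈ insert v D, f' z = Function.update f v y z) : IsSteepest G D f' v (f' v) := by
  have : f' v = y := by rw [hf' v (Set.mem_insert _ _), Function.update_self]
  rw [this]
  refine h.congr fun z hz => ?_
  rw [hf' z (Set.mem_insert_of_mem _ hz), Function.update_of_ne]
  rintro rfl
  exact h.1 hz

end

/-! ## The best extension of a partial colouring -/

section

variable {V : Type*} [Fintype V] (G : SimpleGraph V)

/-- The tones of the edges that are not contained in `D` are bounded by the slopes, and `f` is the
only best extension of its restriction to `D`. -/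
def IsBest (D : Set V) (f : V → ℝ) : Prop :=
  (∀ s, SlopeLE G D f s → ∀ x y, G.Adj x y → x ∉ D → |f x - f y| ≤ s) ∧
    ∀ f' : V → ℝ, (∀ v ∈ D, f' v = f v) → f' ≠ f → gradation G f < gradation G f'

variable {G}

theorem isBest_univ (f : V → ℝ) : IsBest G Set.univ f :=
  ⟨fun _ _ _ _ _ h => absurd (Set.mem_univ _) h,
    fun _ h hne => absurd (funext fun v => h v (Set.mem_univ v)) hne⟩

/-- A competitor that agrees with `f` at `v` loses already as an extension from the larger set; one
that differs at `v` has a tone above `s` outside `D`, where `f` has none. -/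
theorem IsBest.of_insert {D : Set V} {f : V → ℝ} {v : V} (hv : IsSteepest G D f v (f v))
    (h : IsBest G (insert v D) f) : IsBest G D f := by
  obtain ⟨hvD, s, hs, u, u', p, q, hp, hq, hu, hu'⟩ := hv
  have hs0 := hs.nonneg hp hvD
  have hins := hs.insert hvD hp hq hu hu'
  have hadj : ∀ y, G.Adj v y → y ∈ D → |f v - f y| ≤ s := by
    intro y hy hyD
    -- The edge to `y` is itself an exit walk. Pairing it with each half of the steepest pair bounds
    -- the difference of the tones from both sides.
    have hr : IsExit D (SimpleGraph.Walk.cons hy .nil) := (IsExit.nil hyD).cons hy hvD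
    have h1 := hs p _ hvD hp hr
    have h2 := hs _ q hvD hr hq
    simp only [SimpleGraph.Walk.length_cons, SimpleGraph.Walk.length_nil] at h1 h2
    push_cast at h1 h2
    rw [abs_le]
    constructor <;> linarith
  have hedge : ∀ x y, G.Adj x y → x ∉ D → |f x - f y| ≤ s := by
    intro x y hxy hx
    by_cases hxv : x = v
    · subst hxv
      by_cases hy : y ∈ D
      · exact hadj y hxy hy
      -- Read from its other end `y`, the edge starts outside the enlarged set.
      · rw [abs_sub_comm]
        refine h.1 s hins y x hxy.symm fun hy' => ?_
        rcases hy' with rfl | hy'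
        · exact hxy.ne rfl
        · exact hy hy'
    · exact h.1 s hins x y hxy fun hx' => hx'.elim hxv hx
  refine ⟨fun s' hs' x y hxy hx => (hedge x y hxy hx).trans ?_, fun f' hf' hne => ?_⟩
  -- The pair `p`, `q` has slope exactly `s`, so every other bound `s'` is at least `s`.
  · have h1 := hs' p q hvD hp hq
    have h2 : (0 : ℝ) < p.length := by exact_mod_cast hp.length_pos hvD
    have h3 : (0 : ℝ) < q.length := by exact_mod_cast hq.length_pos hvD
    rw [hu, hu'] at h1
    refine le_of_mul_le_mul_right (a := (p.length + q.length : ℝ)) ?_ (by positivity)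
    linarith
  · by_cases hfv : f' v = f v
    · refine h.2 f' (fun z hz => ?_) hne
      rcases hz with rfl | hz
      · exact hfv
      · exact hf' z hz
    -- If all tones of `f'` outside `D` were at most `s`, its tone at `v` would be at least `f u - s
    -- * p.length` and at most `f u' + s * q.length`, and both of these equal `f v`.
    · refine gradation_lt_of_tone_lt G hf' hedge ?_
      by_contra hcon
      push Not at hcon
      refine hfv ?_
      have h1 := IsExit.abs_sub_le hs0 hcon p hp
      have h2 := IsExit.abs_sub_le hs0 hcon q hq
      rw [hf' u hp.1, hu, abs_le] at h1
      rw [hf' u' hq.1, hu', abs_le] at h2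
      linarith

/-- Maximize the slope over the finitely many data of short pairs; `IsExit.exists_short` extends the
bound to all pairs. -/
theorem exists_isSteepest (hG : G.Connected) {D : Set V} (hD : D.Nonempty) (f : V → ℝ) {x₀ : V}
    (hx₀ : x₀ ∉ D) : ∃ v y, IsSteepest G D f v y := by
  classical
  let N := Fintype.card V
  let S : Finset ((V × V × V) × Fin N × Fin N) := Finset.univ.filter fun c =>
    c.1.1 ∉ D ∧ (∃ p : G.Walk c.1.1 c.1.2.1, IsExit D p ∧ p.length = c.2.1) ∧
      ∃ q : G.Walk c.1.1 c.1.2.2, IsExit D q ∧ q.length = c.2.2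
  have hS : ∀ {x u u' : V} {p : G.Walk x u} {q : G.Walk x u'}, x ∉ D → IsExit D p → IsExit D q →
      ∀ (h : p.length < N) (h' : q.length < N),
        ((x, u, u'), ⟨p.length, h⟩, ⟨q.length, h'⟩) ∈ S := by
    intro x u u' p q hx hp hq h h'
    simp only [S, Finset.mem_filter, Finset.mem_univ, true_and]
    exact ⟨hx, ⟨p, hp, rfl⟩, q, hq, rfl⟩
  let sl : (V × V × V) × Fin N × Fin N → ℝ := fun c =>
    (f c.1.2.1 - f c.1.2.2) / ((c.2.1 : ℕ) + (c.2.2 : ℕ))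
  have hne : S.Nonempty := by
    obtain ⟨u, q, hq⟩ := exists_isExit hG hD x₀
    obtain ⟨q', hq', -, hlt⟩ := hq.exists_short
    exact ⟨_, hS hx₀ hq' hq' hlt hlt⟩
  obtain ⟨⟨⟨x, u, u'⟩, j, k⟩, hm, hmax⟩ := Finset.exists_max_image S sl hne
  simp only [S, Finset.mem_filter, Finset.mem_univ, true_and] at hm
  obtain ⟨hx, ⟨p, hp, hpj⟩, q, hq, hqk⟩ := hm
  set s := sl ((x, u, u'), j, k) with hsdef
  have hpos : ∀ {x u u' : V} {p : G.Walk x u} {q : G.Walk x u'}, x ∉ D → IsExit D p →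
      (0 : ℝ) < p.length + q.length := by
    intro x u u' p q hx hp
    have : (0 : ℝ) < p.length := by exact_mod_cast hp.length_pos hx
    positivity
  have hshort : ∀ {x u u' : V} (p : G.Walk x u) (q : G.Walk x u'), x ∉ D → IsExit D p →
      IsExit D q → p.length < N → q.length < N → f u - f u' ≤ s * (p.length + q.length) := by
    intro x u u' p q hx hp hq h h'
    have := hmax _ (hS hx hp hq h h')
    simp only [sl] at this
    rwa [div_le_iff₀ (hpos hx hp)] at this
  -- Needed to pass from short walks to long ones: a longer walk weakens the bound only if the slope
  -- is nonnegative.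
  have hs0 : 0 ≤ s := by
    obtain ⟨p', hp', -, hlt⟩ := hp.exists_short
    have h1 := hshort p' p' hx hp' hp' hlt hlt
    have h2 := hpos (q := p') hx hp'
    rw [sub_self] at h1
    by_contra hs
    nlinarith
  -- The tone is interpolated from the end `u`; the equation at `u'` expresses that this pair
  -- attains the slope `s`.
  refine ⟨x, f u - s * p.length, hx, s, ?_, u, u', p, q, hp, hq, by ring, ?_⟩
  · intro x u u' p q hx hp hq
    obtain ⟨p', hp', hle, hlt⟩ := hp.exists_short
    obtain ⟨q', hq', hle', hlt'⟩ := hq.exists_short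
    refine (hshort p' q' hx hp' hq' hlt hlt').trans (mul_le_mul_of_nonneg_left ?_ hs0)
    exact_mod_cast Nat.add_le_add hle hle'
  · have h1 : s * (p.length + q.length) = f u - f u' := by
      rw [hsdef]
      simp only [sl]
      rw [← hpj, ← hqk]
      exact div_mul_cancel₀ _ (hpos hx hp).ne'
    linarith

/-- Induction on the number of uncoloured vertices: colour a vertex of a steepest pair, extend, and
return with `IsBest.of_insert`. -/
theorem exists_isBest (hG : G.Connected) {D : Set V} (hD : D.Nonempty) (f : V → ℝ) :
    ∃ f' : V → ℝ, (∀ v ∈ D, f' v = f v) ∧ IsBest G D f' ∧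
      ((∀ v ∈ D, f v ∈ Set.Icc (0 : ℝ) 1) → ∀ v, f' v ∈ Set.Icc (0 : ℝ) 1) := by
  classical
  induction hn : Dᶜ.ncard using Nat.strong_induction_on generalizing D f with
  | _ n ih =>
    by_cases hu : D = Set.univ
    · subst hu
      exact ⟨f, fun _ _ => rfl, isBest_univ f, fun h v => h v (Set.mem_univ v)⟩
    · obtain ⟨x₀, hx₀⟩ := (Set.ne_univ_iff_exists_notMem D).1 hu
      obtain ⟨v, y, hv⟩ := exists_isSteepest hG hD f hx₀
      have hfin := Set.toFinite Dᶜ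
      have hlt : (insert v D)ᶜ.ncard < n := by
        rw [← hn]
        refine Set.ncard_lt_ncard ?_ hfin
        rw [Set.ssubset_iff_of_subset]
        · exact ⟨v, hv.1, by simp⟩
        · exact Set.compl_subset_compl.2 (Set.subset_insert _ _)
      obtain ⟨f', hf', hb, hI⟩ := ih _ hlt (Set.insert_nonempty v D) (Function.update f v y) rfl
      have hst := hv.congr_update hf'
      have hne : ∀ z ∈ D, z ≠ v := by
        rintro z hz rfl
        exact hv.1 hz
      refine ⟨f', fun z hz => ?_, hb.of_insert hst, fun h => hI fun z hz => ?_⟩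
      · rw [hf' z (Set.mem_insert_of_mem _ hz), Function.update_of_ne (hne z hz)]
      · rcases hz with rfl | hz
        · rw [Function.update_self]
          exact hv.mem_Icc h
        · rw [Function.update_of_ne (hne z hz)]
          exact h z hz

theorem IsBest.unique {D : Set V} {f f' : V → ℝ} (h : IsBest G D f) (h' : IsBest G D f')
    (heq : ∀ v ∈ D, f' v = f v) : f' = f := by
  by_contra hne
  exact lt_asymm (h.2 f' heq hne) (h'.2 f (fun v hv => (heq v hv).symm) (Ne.symm hne))

/-- The best extension of a colouring of `D`. -/
noncomputable def bestExt (hG : G.Connected) {D : Set V} (hD : D.Nonempty) (f : V → ℝ) : V → ℝ :=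
  (exists_isBest hG hD f).choose

variable (hG : G.Connected) {D : Set V} (hD : D.Nonempty)

theorem bestExt_eq {f : V → ℝ} {v : V} (hv : v ∈ D) : bestExt hG hD f v = f v :=
  (exists_isBest hG hD f).choose_spec.1 v hv

theorem isBest_bestExt (f : V → ℝ) : IsBest G D (bestExt hG hD f) :=
  (exists_isBest hG hD f).choose_spec.2.1

theorem bestExt_mem_Icc {f : V → ℝ} (hf : ∀ v ∈ D, f v ∈ Set.Icc (0 : ℝ) 1) (v : V) :
    bestExt hG hD f v ∈ Set.Icc (0 : ℝ) 1 :=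
  (exists_isBest hG hD f).choose_spec.2.2 hf v

theorem gradation_bestExt_le {f f' : V → ℝ} (h : ∀ v ∈ D, f' v = f v) :
    gradation G (bestExt hG hD f) ≤ gradation G f' := by
  by_cases hne : f' = bestExt hG hD f
  · rw [hne]
  · exact ((isBest_bestExt hG hD f).2 f'
      (fun v hv => by rw [h v hv, bestExt_eq hG hD hv]) hne).le

theorem eq_bestExt {f f' : V → ℝ} (h : ∀ v ∈ D, f' v = f v)
    (hle : gradation G f' ≤ gradation G (bestExt hG hD f)) : f' = bestExt hG hD f := by
  by_contra hne
  exact absurd ((isBest_bestExt hG hD f).2 f'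
      (fun v hv => by rw [h v hv, bestExt_eq hG hD hv]) hne) (not_lt.2 hle)

/-- The invariant of the algorithm: colouring a vertex on a steepest pair does not change the best
extension. -/
theorem IsSteepest.bestExt_insert [DecidableEq V] {f : V → ℝ} {v : V} {y : ℝ}
    (hv : IsSteepest G D f v y) :
    bestExt hG (Set.insert_nonempty v D) (Function.update f v y) = bestExt hG hD f := by
  have hst := hv.congr_update (f' := bestExt hG (Set.insert_nonempty v D) (Function.update f v y))
    fun z hz => bestExt_eq hG _ hz
  refine (isBest_bestExt hG hD f).unique ((isBest_bestExt hG _ _).of_insert hst) fun z hz => ?_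
  rw [bestExt_eq hG _ (Set.mem_insert_of_mem _ hz), bestExt_eq hG hD hz, Function.update_of_ne]
  rintro rfl
  exact hv.1 hz

end

end Greyscale

/-! ## Structured code for the real random access machine -/

namespace RealRAM

/-- Code with bounded loops: `forN i p` repeats `p` for `i = 0, …, n - 1`, where `n` is the value
of the index variable `0`. -/
inductive Code where
  | skip
  | setIdx (x : ℕ) (e : IdxExpr)
  | setReal (x : ℕ) (e : RealExpr)
  | storeIdx (a : ℕ) (i j : IdxExpr) (e : IdxExpr)
  | storeReal (a : ℕ) (i j : IdxExpr) (e : RealExpr)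
  | seq (p q : Code)
  | ite (b : Test) (p q : Code)
  | forN (i : ℕ) (p : Code)

infixr:60 " ;; " => Code.seq

namespace State

/-- Assignment to an index variable. -/
def setI (s : State) (x v : ℕ) : State := { s with idxVar := Function.update s.idxVar x v }

/-- Assignment to a real variable. -/
def setR (s : State) (x : ℕ) (v : ℝ) : State :=
  { s with realVar := Function.update s.realVar x v }

/-- Assignment to an entry of an index array. -/
def storeI (s : State) (a i j v : ℕ) : State := { s with idxArr := updateArr s.idxArr a i j v }

/-- Assignment to an entry of a real array. -/
def storeR (s : State) (a i j : ℕ) (v : ℝ) : State :=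
  { s with realArr := updateArr s.realArr a i j v }

variable (s : State) (a i j x v k : ℕ) (y : ℝ)

@[simp] theorem setI_idxVar : (s.setI x v).idxVar k = if k = x then v else s.idxVar k :=
  Function.update_apply ..
@[simp] theorem setI_realVar : (s.setI x v).realVar = s.realVar := rfl
@[simp] theorem setI_idxArr : (s.setI x v).idxArr = s.idxArr := rfl
@[simp] theorem setI_realArr : (s.setI x v).realArr = s.realArr := rfl
@[simp] theorem setR_idxVar : (s.setR x y).idxVar = s.idxVar := rfl
@[simp] theorem setR_realVar : (s.setR x y).realVar k = if k = x then y else s.realVar k :=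
  Function.update_apply ..
@[simp] theorem setR_idxArr : (s.setR x y).idxArr = s.idxArr := rfl
@[simp] theorem setR_realArr : (s.setR x y).realArr = s.realArr := rfl
@[simp] theorem storeI_idxVar : (s.storeI a i j v).idxVar = s.idxVar := rfl
@[simp] theorem storeI_realVar : (s.storeI a i j v).realVar = s.realVar := rfl
@[simp] theorem storeI_idxArr (a' i' j' : ℕ) : (s.storeI a i j v).idxArr a' i' j' =
    if a' = a ∧ i' = i ∧ j' = j then v else s.idxArr a' i' j' := rfl
@[simp] theorem storeI_realArr : (s.storeI a i j v).realArr = s.realArr := rfl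
@[simp] theorem storeR_idxVar : (s.storeR a i j y).idxVar = s.idxVar := rfl
@[simp] theorem storeR_realVar : (s.storeR a i j y).realVar = s.realVar := rfl
@[simp] theorem storeR_idxArr : (s.storeR a i j y).idxArr = s.idxArr := rfl
@[simp] theorem storeR_realArr (a' i' j' : ℕ) : (s.storeR a i j y).realArr a' i' j' =
    if a' = a ∧ i' = i ∧ j' = j then y else s.realArr a' i' j' := rfl

end State

namespace Code

/-- The program given by a piece of code. -/
def toProgram : Code → Program
  | skip => .skip
  | setIdx x e => .setIdx x e
  | setReal x e => .setReal x e
  | storeIdx a i j e => .storeIdx a i j e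
  | storeReal a i j e => .storeReal a i j e
  | seq p q => .seq p.toProgram q.toProgram
  | ite b p q => .ite b p.toProgram q.toProgram
  -- Only the comparison `≤` is available, so `i < n` is tested as `i + 1 ≤ n`.
  | forN i p => .seq (.setIdx i (.lit 0)) (.loop (.idxLe (.add (.var i) (.lit 1)) (.var 0))
      (.seq p.toProgram (.setIdx i (.add (.var i) (.lit 1)))))

open Classical in
/-- The final state. -/
noncomputable def run : Code → State → State
  | skip, s => s
  | setIdx x e, s => s.setI x (e.eval s)
  | setReal x e, s => s.setR x (e.eval s)
  | storeIdx a i j e, s => s.storeI a (i.eval s) (j.eval s) (e.eval s)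
  | storeReal a i j e, s => s.storeR a (i.eval s) (j.eval s) (e.eval s)
  | seq p q, s => q.run (p.run s)
  | ite b p q, s => if b.Holds s then p.run s else q.run s
  | forN i p, s =>
      Nat.rec (s.setI i 0) (fun k t => (p.run t).setI i (k + 1)) (s.idxVar 0)

section

open Classical in
theorem run_ite (b : Test) (p q : Code) (s : State) :
    (ite b p q).run s = if b.Holds s then p.run s else q.run s := rfl

theorem run_skip (s : State) : skip.run s = s := rfl
theorem run_seq (p q : Code) (s : State) : (p ;; q).run s = q.run (p.run s) := rfl
theorem run_setIdx (x : ℕ) (e : IdxExpr) (s : State) :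
    (setIdx x e).run s = s.setI x (e.eval s) := rfl
theorem run_setReal (x : ℕ) (e : RealExpr) (s : State) :
    (setReal x e).run s = s.setR x (e.eval s) := rfl
theorem run_storeIdx (a : ℕ) (i j e : IdxExpr) (s : State) :
    (storeIdx a i j e).run s = s.storeI a (i.eval s) (j.eval s) (e.eval s) := rfl
theorem run_storeReal (a : ℕ) (i j : IdxExpr) (e : RealExpr) (s : State) :
    (storeReal a i j e).run s = s.storeR a (i.eval s) (j.eval s) (e.eval s) := rfl

end

/-! ### Frame conditions: memory cells that a piece of code leaves alone -/

/-- The index variables that may be changed. -/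
def idxVars : Code → List ℕ
  | setIdx x _ => [x]
  | seq p q => p.idxVars ++ q.idxVars
  | ite _ p q => p.idxVars ++ q.idxVars
  | forN i p => i :: p.idxVars
  | _ => []

/-- The real variables that may be changed. -/
def realVars : Code → List ℕ
  | setReal x _ => [x]
  | seq p q => p.realVars ++ q.realVars
  | ite _ p q => p.realVars ++ q.realVars
  | forN _ p => p.realVars
  | _ => []

/-- The index arrays that may be changed. -/
def idxArrs : Code → List ℕ
  | storeIdx a _ _ _ => [a]
  | seq p q => p.idxArrs ++ q.idxArrs
  | ite _ p q => p.idxArrs ++ q.idxArrs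
  | forN _ p => p.idxArrs
  | _ => []

/-- The real arrays that may be changed. -/
def realArrs : Code → List ℕ
  | storeReal a _ _ _ => [a]
  | seq p q => p.realArrs ++ q.realArrs
  | ite _ p q => p.realArrs ++ q.realArrs
  | forN _ p => p.realArrs
  | _ => []

/-- The loop variables are not changed in the body of the loop, and the index variable `0` is
not changed at all. -/
def WellFormed : Code → Prop
  | setIdx x _ => x ≠ 0
  | seq p q => p.WellFormed ∧ q.WellFormed
  | ite _ p q => p.WellFormed ∧ q.WellFormed
  | forN i p => i ≠ 0 ∧ i ∉ p.idxVars ∧ p.WellFormed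
  | _ => True

/-- `p` does not change the memory cells in which `s` and `t` differ. -/
structure Frame (p : Code) (s t : State) : Prop where
  idxVar : ∀ x, x ∉ p.idxVars → t.idxVar x = s.idxVar x
  realVar : ∀ x, x ∉ p.realVars → t.realVar x = s.realVar x
  idxArr : ∀ a, a ∉ p.idxArrs → t.idxArr a = s.idxArr a
  realArr : ∀ a, a ∉ p.realArrs → t.realArr a = s.realArr a

theorem Frame.refl (p : Code) (s : State) : p.Frame s s :=
  ⟨fun _ _ => rfl, fun _ _ => rfl, fun _ _ => rfl, fun _ _ => rfl⟩

theorem Frame.trans {p : Code} {s t u : State} (h : p.Frame s t) (h' : p.Frame t u) :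
    p.Frame s u :=
  ⟨fun x hx => (h'.idxVar x hx).trans (h.idxVar x hx),
    fun x hx => (h'.realVar x hx).trans (h.realVar x hx),
    fun x hx => (h'.idxArr x hx).trans (h.idxArr x hx),
    fun x hx => (h'.realArr x hx).trans (h.realArr x hx)⟩

theorem Frame.mono {p q : Code} {s t : State} (h : p.Frame s t) (hI : p.idxVars ⊆ q.idxVars)
    (hR : p.realVars ⊆ q.realVars) (hIA : p.idxArrs ⊆ q.idxArrs)
    (hRA : p.realArrs ⊆ q.realArrs) : q.Frame s t :=
  ⟨fun x hx => h.idxVar x fun h' => hx (hI h'), fun x hx => h.realVar x fun h' => hx (hR h'),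
    fun x hx => h.idxArr x fun h' => hx (hIA h'), fun x hx => h.realArr x fun h' => hx (hRA h')⟩

theorem frame_forN_setI (i v : ℕ) (p : Code) (s : State) : (forN i p).Frame s (s.setI i v) := by
  refine ⟨fun x hx => ?_, fun _ _ => rfl, fun _ _ => rfl, fun _ _ => rfl⟩
  simp only [idxVars, List.mem_cons, not_or] at hx
  simp [hx.1]

theorem frame_run (p : Code) (s : State) : p.Frame s (p.run s) := by
  induction p generalizing s with
  | skip => exact .refl _ _
  | setIdx x e =>
    refine ⟨fun y hy => ?_, fun _ _ => rfl, fun _ _ => rfl, fun _ _ => rfl⟩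
    simp only [idxVars, List.mem_singleton] at hy
    simp [run, hy]
  | setReal x e =>
    refine ⟨fun _ _ => rfl, fun y hy => ?_, fun _ _ => rfl, fun _ _ => rfl⟩
    simp only [realVars, List.mem_singleton] at hy
    simp [run, hy]
  | storeIdx a i j e =>
    refine ⟨fun _ _ => rfl, fun _ _ => rfl, fun b hb => ?_, fun _ _ => rfl⟩
    simp only [idxArrs, List.mem_singleton] at hb
    funext i j
    simp [run, hb]
  | storeReal a i j e =>
    refine ⟨fun _ _ => rfl, fun _ _ => rfl, fun _ _ => rfl, fun b hb => ?_⟩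
    simp only [realArrs, List.mem_singleton] at hb
    funext i j
    simp [run, hb]
  | seq p q ihp ihq =>
    exact ((ihp s).mono (List.subset_append_left ..) (List.subset_append_left ..)
      (List.subset_append_left ..) (List.subset_append_left ..)).trans ((ihq _).mono
      (List.subset_append_right ..) (List.subset_append_right ..)
      (List.subset_append_right ..) (List.subset_append_right ..))
  | ite b p q ihp ihq =>
    rw [run]
    split_ifs
    · exact (ihp s).mono (List.subset_append_left ..) (List.subset_append_left ..)
        (List.subset_append_left ..) (List.subset_append_left ..)
    · exact (ihq s).mono (List.subset_append_right ..) (List.subset_append_right ..)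
        (List.subset_append_right ..) (List.subset_append_right ..)
  | forN i p ih =>
    rw [run]
    induction s.idxVar 0 with
    | zero => exact frame_forN_setI ..
    | succ k ihk =>
      exact (ihk.trans ((ih _).mono (List.subset_cons_self ..) (List.Subset.refl _)
        (List.Subset.refl _) (List.Subset.refl _))).trans (frame_forN_setI ..)

/-- Induction along a loop. -/
theorem run_forN_induction {i : ℕ} {p : Code} (I : ℕ → State → Prop) (s : State)
    (h0 : I 0 (s.setI i 0))
    (hs : ∀ k t, k < s.idxVar 0 → t.idxVar i = k → (forN i p).Frame s t → I k t →
      I (k + 1) ((p.run t).setI i (k + 1))) : I (s.idxVar 0) ((forN i p).run s) := by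
  rw [run]
  -- The induction also carries the value of the loop counter and the frame condition, on which the
  -- step hypothesis relies.
  suffices ∀ k ≤ s.idxVar 0,
      (Nat.rec (s.setI i 0) (fun k t => (p.run t).setI i (k + 1)) k : State).idxVar i = k ∧
      (forN i p).Frame s (Nat.rec (s.setI i 0) (fun k t => (p.run t).setI i (k + 1)) k) ∧
      I k (Nat.rec (s.setI i 0) (fun k t => (p.run t).setI i (k + 1)) k) from
    (this _ le_rfl).2.2
  intro k hk
  induction k with
  | zero => exact ⟨by simp, frame_forN_setI .., h0⟩
  | succ k ih =>
    obtain ⟨h1, h2, h3⟩ := ih (by omega)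
    refine ⟨by simp, ?_, hs k _ (by omega) h1 h2 h3⟩
    exact (h2.trans ((frame_run p _).mono (List.subset_cons_self ..) (List.Subset.refl _)
        (List.Subset.refl _) (List.Subset.refl _))).trans (frame_forN_setI ..)

/-! ### Running time and translation into programs -/

/-- A bound for the running time. -/
def cost : Code → ℕ → ℕ
  | skip, _ => 1
  | setIdx _ e, _ => e.cost + 1
  | setReal _ e, _ => e.cost + 1
  | storeIdx _ i j e, _ => i.cost + j.cost + e.cost + 1
  | storeReal _ i j e, _ => i.cost + j.cost + e.cost + 1
  | seq p q, n => p.cost n + q.cost n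
  | ite b p q, n => b.cost + 1 + (p.cost n + q.cost n)
  -- An iteration spends 6 units on the test and 4 on the increment; the initial assignment and the
  -- last test take 2 and 6.
  | forN _ p, n => n * (p.cost n + 10) + 8

/-- The nesting depth of the loops. -/
def depth : Code → ℕ
  | seq p q => max p.depth q.depth
  | ite _ p q => max p.depth q.depth
  | forN _ p => p.depth + 1
  | _ => 0

/-- Each loop contributes a factor `n`. Powers with different exponents are compared by `1 ≤ n`. -/
theorem exists_cost_le (p : Code) : ∃ C, ∀ n, 1 ≤ n → p.cost n ≤ C * n ^ p.depth := by
  have two : ∀ {p q : Code}, (∃ C, ∀ n, 1 ≤ n → p.cost n ≤ C * n ^ p.depth) →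
      (∃ C, ∀ n, 1 ≤ n → q.cost n ≤ C * n ^ q.depth) →
      ∃ C, ∀ n, 1 ≤ n → p.cost n + q.cost n ≤ C * n ^ max p.depth q.depth := by
    rintro p q ⟨C, hC⟩ ⟨C', hC'⟩
    refine ⟨C + C', fun n hn => ?_⟩
    rw [add_mul]
    exact Nat.add_le_add
      ((hC n hn).trans (Nat.mul_le_mul_left _ (Nat.pow_le_pow_right hn (le_max_left ..))))
      ((hC' n hn).trans (Nat.mul_le_mul_left _ (Nat.pow_le_pow_right hn (le_max_right ..))))
  induction p with
  | skip => exact ⟨_, fun n _ => (mul_one _).ge⟩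
  | setIdx x e => exact ⟨_, fun n _ => (mul_one _).ge⟩
  | setReal x e => exact ⟨_, fun n _ => (mul_one _).ge⟩
  | storeIdx a i j e => exact ⟨_, fun n _ => (mul_one _).ge⟩
  | storeReal a i j e => exact ⟨_, fun n _ => (mul_one _).ge⟩
  | seq p q ihp ihq => exact two ihp ihq
  | ite b p q ihp ihq =>
    obtain ⟨C, hC⟩ := two ihp ihq
    refine ⟨b.cost + 1 + C, fun n hn => ?_⟩
    rw [cost, depth, add_mul]
    exact Nat.add_le_add (Nat.le_mul_of_pos_right _ (by positivity)) (hC n hn)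
  | forN i p ih =>
    obtain ⟨C, hC⟩ := ih
    -- The overhead `10 * n + 8` is at most 18 times the new power.
    refine ⟨C + 18, fun n hn => ?_⟩
    rw [cost, depth]
    have h1 := Nat.mul_le_mul_left n (hC n hn)
    have h2 : n ≤ n ^ (p.depth + 1) := Nat.le_self_pow (by omega) n
    have h3 : (C + 18) * n ^ (p.depth + 1) = n * (C * n ^ p.depth) + 18 * n ^ (p.depth + 1) := by
      ring
    rw [h3, mul_add]
    omega

theorem notMem_idxVars {p : Code} (h : p.WellFormed) : 0 ∉ p.idxVars := by
  induction p with
  | skip | setReal | storeIdx | storeReal => simp [idxVars]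
  | setIdx x e => simpa [idxVars] using Ne.symm h
  | seq p q ihp ihq => simp [idxVars, ihp h.1, ihq h.2]
  | ite b p q ihp ihq => simp [idxVars, ihp h.1, ihq h.2]
  | forN i p ih => simp [idxVars, ih h.2.2, Ne.symm h.1]

/-- Well-formedness protects the loop counter and the bound `n` from the loop body, so the while
loop makes exactly `n` iterations. -/
theorem exists_runs {p : Code} (h : p.WellFormed) (s : State) :
    ∃ t, Runs p.toProgram s t (p.run s) ∧ t ≤ p.cost (s.idxVar 0) := by
  induction p generalizing s with
  | skip => exact ⟨_, .skip s, le_rfl⟩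
  | setIdx x e => exact ⟨_, .setIdx s x e, le_rfl⟩
  | setReal x e => exact ⟨_, .setReal s x e, le_rfl⟩
  | storeIdx a i j e => exact ⟨_, .storeIdx s a i j e, le_rfl⟩
  | storeReal a i j e => exact ⟨_, .storeReal s a i j e, le_rfl⟩
  | seq p q ihp ihq =>
    obtain ⟨t, ht, hle⟩ := ihp h.1 s
    obtain ⟨t', ht', hle'⟩ := ihq h.2 (p.run s)
    rw [(frame_run p s).idxVar 0 (notMem_idxVars h.1)] at hle'
    exact ⟨_, .seq ht ht', Nat.add_le_add hle hle'⟩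
  | ite b p q ihp ihq =>
    obtain ⟨t, ht, hle⟩ := ihp h.1 s
    obtain ⟨t', ht', hle'⟩ := ihq h.2 s
    rw [run, cost]
    split_ifs with hb
    · exact ⟨_, .iteTrue hb ht, by omega⟩
    · exact ⟨_, .iteFalse hb ht', by omega⟩
  | forN i p ih =>
    obtain ⟨hi, hip, hp⟩ := h
    have h0 := notMem_idxVars hp
    rw [run, cost]
    set n := s.idxVar 0 with hn
    let σ : ℕ → State := fun k => Nat.rec (s.setI i 0) (fun k t => (p.run t).setI i (k + 1)) k
    have hσ : ∀ k, (σ k).idxVar i = k ∧ (σ k).idxVar 0 = n := by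
      intro k
      induction k with
      | zero => simp [σ, Ne.symm hi, hn]
      | succ k ihk =>
        refine ⟨by simp [σ], ?_⟩
        simp only [σ, State.setI_idxVar, if_neg (Ne.symm hi)]
        exact ((frame_run p (σ k)).idxVar 0 h0).trans ihk.2
    -- Induction on the number `m` of remaining iterations, starting from the state `σ k` after `k`
    -- of them.
    have hloop : ∀ m k, k + m = n → ∃ t, Runs (.loop (.idxLe (.add (.var i) (.lit 1)) (.var 0))
        (.seq p.toProgram (.setIdx i (.add (.var i) (.lit 1))))) (σ k) t (σ n) ∧
        t ≤ m * (p.cost n + 10) + 6 := by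
      intro m
      induction m with
      | zero =>
        rintro k rfl
        refine ⟨_, .loopDone ?_, ?_⟩
        · simp [Test.Holds, IdxExpr.eval, hσ]
        · simp [Test.cost, IdxExpr.cost]
      | succ m ihm =>
        intro k hk
        obtain ⟨t', ht', hle'⟩ := ihm (k + 1) (by omega)
        obtain ⟨t, ht, hle⟩ := ih hp (σ k)
        have hset := Runs.setIdx (p.run (σ k)) i (.add (.var i) (.lit 1))
        have heq : ({ p.run (σ k) with
            idxVar := Function.update (p.run (σ k)).idxVar i
              ((IdxExpr.add (.var i) (.lit 1)).eval (p.run (σ k))) } : State) = σ (k + 1) := by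
          change State.setI _ _ _ = State.setI _ _ _
          simp only [IdxExpr.eval]
          rw [(frame_run p (σ k)).idxVar i hip, (hσ k).1]
        rw [heq] at hset
        refine ⟨_, .loopStep ?_ (.seq ht hset) ht', ?_⟩
        · simp only [Test.Holds, IdxExpr.eval, hσ]
          omega
        · rw [(hσ k).2] at hle
          simp only [Test.cost, IdxExpr.cost, add_mul]
          omega
    obtain ⟨t, ht, hle⟩ := hloop n 0 (by omega)
    refine ⟨_, .seq (.setIdx s i (.lit 0)) ht, ?_⟩
    simp only [IdxExpr.cost]
    omega

end Code

end RealRAM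

namespace RealRAM

namespace Code

-- Frame side conditions are decided by unfolding these lists, so all cells have fixed numbers.
-- Index variables: 0 is `n`, 1 the length of the output list, 2 the vertex `w`, 3 the round, 8 the
-- best vertex; 4, 5, 6, 7, 9 count inner loops. Real variables: 0 is the missing tone, 1 a running
-- maximum, 2 a slope, 3 and 4 the best slope and its tone, 5 a tone to be tested, 6 an edge tone, 7
-- and 8 the highest tone with different multiplicities and their difference, 9 a count. Index
-- arrays: 0 is the adjacency matrix, 1 and 2 mark the given and the currently coloured vertices.
-- Real arrays: 0 is the given colouring, 1 the output list, 2 the current colouring, 3 and 4 the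
-- tables.
attribute [simp] idxVars realVars idxArrs realArrs

/-! ## Loops that search a maximum or compute a sum -/

/-- `b` arises from `a` by updating the maximum of the first component with the elements
of `S`. -/
structure IsMaxStep {δ : Type*} (S : Set (ℝ × δ)) (a b : ℝ × δ) : Prop where
  le : a.1 ≤ b.1
  ub : ∀ c ∈ S, c.1 ≤ b.1
  mem : b = a ∨ b ∈ S

theorem IsMaxStep.refl {δ : Type*} {S : Set (ℝ × δ)} {a : ℝ × δ} (h : ∀ c ∈ S, c.1 ≤ a.1) :
    IsMaxStep S a a :=
  ⟨le_rfl, h, Or.inl rfl⟩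

theorem IsMaxStep.trans {δ : Type*} {S T U : Set (ℝ × δ)} {a b c : ℝ × δ} (h : IsMaxStep S a b)
    (h' : IsMaxStep T b c) (hU : ∀ x, x ∈ U ↔ x ∈ S ∨ x ∈ T) : IsMaxStep U a c := by
  refine ⟨h.le.trans h'.le, fun x hx => ?_, ?_⟩
  · rcases (hU x).1 hx with hx | hx
    · exact (h.ub x hx).trans h'.le
    · exact h'.ub x hx
  · rcases h'.mem with rfl | hc
    · exact h.mem.imp_right fun hb => (hU _).2 (Or.inl hb)
    · exact Or.inr ((hU _).2 (Or.inr hc))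

/-- `π` reads the running maximum together with its data; `hπ` says that the loop counter is not
among these cells. -/
theorem isMaxStep_forN {δ : Type*} (π : State → ℝ × δ) (S : ℕ → Set (ℝ × δ)) {i : ℕ} {p : Code}
    (s : State) (hπ : ∀ t v, π (t.setI i v) = π t)
    (h : ∀ k t, k < s.idxVar 0 → t.idxVar i = k → (forN i p).Frame s t →
      IsMaxStep (S k) (π t) (π (p.run t))) :
    IsMaxStep {c | ∃ k < s.idxVar 0, c ∈ S k} (π s) (π ((forN i p).run s)) := by
  refine run_forN_induction
    (fun m t => IsMaxStep {c | ∃ k < m, c ∈ S k} (π s) (π t)) s ?_ fun k t hk hi hf ih => ?_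
  · rw [hπ]
    exact .refl fun c ⟨k, hk, _⟩ => absurd hk (Nat.not_lt_zero k)
  · rw [hπ]
    refine ih.trans (h k t hk hi hf) fun c => ?_
    simp only [Set.mem_ofPred_eq, Nat.lt_succ_iff_lt_or_eq]
    constructor
    · rintro ⟨j, hj | rfl, hc⟩
      · exact Or.inl ⟨j, hj, hc⟩
      · exact Or.inr hc
    · rintro (⟨j, hj, hc⟩ | hc)
      · exact ⟨j, Or.inl hj, hc⟩
      · exact ⟨k, Or.inr rfl, hc⟩

theorem sum_forN (π : State → ℝ) (c : ℕ → ℝ) {i : ℕ} {p : Code} (s : State)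
    (hπ : ∀ t v, π (t.setI i v) = π t)
    (h : ∀ k t, k < s.idxVar 0 → t.idxVar i = k → (forN i p).Frame s t →
      π (p.run t) = π t + c k) :
    π ((forN i p).run s) = π s + ∑ k ∈ Finset.range (s.idxVar 0), c k := by
  refine run_forN_induction
    (fun m t => π t = π s + ∑ k ∈ Finset.range m, c k) s (by simp [hπ]) fun k t hk hi hf ih => ?_
  rw [hπ, h k t hk hi hf, ih, Finset.sum_range_succ, add_assoc]

end Code

/-! ## The graph and the colouring in the memory -/

/-- The adjacency matrix of `G` is stored in the index array `0`. -/
structure HasGraph {n : ℕ} (G : SimpleGraph (Fin n)) (s : State) : Prop where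
  size : s.idxVar 0 = n
  adj : ∀ i j : Fin n, 1 ≤ s.idxArr 0 i j ↔ G.Adj i j

theorem HasGraph.of_eq {n : ℕ} {G : SimpleGraph (Fin n)} {s t : State} (h : HasGraph G s)
    (h0 : t.idxVar 0 = s.idxVar 0) (h1 : t.idxArr 0 = s.idxArr 0) : HasGraph G t :=
  ⟨h0.trans h.size, fun i j => by rw [h1]; exact h.adj i j⟩

theorem HasGraph.of_frame {n : ℕ} {G : SimpleGraph (Fin n)} {s t : State} (h : HasGraph G s)
    {p : Code} (hf : p.Frame s t) (hp : 0 ∉ p.idxVars) (hp' : 0 ∉ p.idxArrs) : HasGraph G t :=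
  h.of_eq (hf.idxVar 0 hp) (hf.idxArr 0 hp')

/-- The set of the coloured vertices. -/
def coloured (n : ℕ) (s : State) : Set (Fin n) := {i | 1 ≤ s.idxArr 2 i 0}

/-- The current colouring. -/
def colouring (n : ℕ) (s : State) : Fin n → ℝ := fun i => s.realArr 2 i 0

namespace Code

/-- Adjacency of the vertices in the index variables `x` and `y`. -/
def adjTest (x y : ℕ) : Test := .idxLe (.lit 1) (.get 0 (.var x) (.var y))

/-- The vertex in the index variable `x` is marked in the index array `a`. -/
def markTest (a x : ℕ) : Test := .idxLe (.lit 1) (.get a (.var x) (.lit 0))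

/-- The real number `-1`. -/
def negOne : RealExpr := .sub (.lit 0) (.lit 1)

/-! ## The table of the highest tones that can be reached -/

/-- Update the maximum in the real variable `1` with a neighbour. -/
def maxStep (a : ℕ) : Code :=
  ite (adjTest 5 6)
    (ite (.realLe (.get a (.var 4) (.var 6)) (.var 1)) skip
      (setReal 1 (.get a (.var 4) (.var 6)))) skip

/-- Compute the entry of the table for the vertex in the index variable `5`. -/
def tableEntry (e : RealExpr) (a : ℕ) : Code :=
  setReal 1 negOne ;; forN 6 (maxStep a) ;; ite (markTest 2 5) (setReal 1 e) skip ;;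
    storeReal a (.add (.var 4) (.lit 1)) (.var 5) (.var 1)

/-- Compute the first row of the table. -/
def tableInit (e : RealExpr) (a : ℕ) : Code :=
  forN 5 (ite (markTest 2 5) (setReal 1 e) (setReal 1 negOne) ;;
    storeReal a (.lit 0) (.var 5) (.var 1))

/-- Compute the table. -/
def table (e : RealExpr) (a : ℕ) : Code := tableInit e a ;; forN 4 (forN 5 (tableEntry e a))

/-- The row `r` contains the highest tones that can be reached in at most `k` steps. -/
structure IsRow {n : ℕ} (G : SimpleGraph (Fin n)) (D : Set (Fin n)) (f : Fin n → ℝ) (k : ℕ)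
    (r : ℕ → ℝ) : Prop where
  le : ∀ ⦃x u : Fin n⦄ (p : G.Walk x u), Greyscale.IsExit D p → p.length ≤ k → f u ≤ r x
  mem : ∀ x : Fin n, r x = -1 ∨
    ∃ (u : Fin n) (p : G.Walk x u), Greyscale.IsExit D p ∧ p.length ≤ k ∧ r x = f u

section

variable {n : ℕ} {G : SimpleGraph (Fin n)} {D : Set (Fin n)} {f : Fin n → ℝ}

theorem isRow_zero {r : ℕ → ℝ} (h : ∀ x : Fin n, x ∈ D → r x = f x)
    (h' : ∀ x : Fin n, x ∉ D → r x = -1) : IsRow G D f 0 r := by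
  refine ⟨fun x u p hp hl => ?_, fun x => ?_⟩
  · cases p with
    | nil => exact (h x hp.1).ge
    | cons => simp at hl
  · by_cases hx : x ∈ D
    · exact Or.inr ⟨x, .nil, .nil hx, le_rfl, h x hx⟩
    · exact Or.inl (h' x hx)

/-- The recursion of the dynamic programme: from outside `D` an exit walk is an edge followed by a
shorter exit walk, while from a vertex of `D` it can only end where it starts. -/
theorem IsRow.succ {k : ℕ} {r r' : ℕ → ℝ} (hr : IsRow G D f k r)
    (h : ∀ x : Fin n, x ∈ D → r' x = f x)
    (h' : ∀ x : Fin n, x ∉ D → (∀ y, G.Adj x y → r y ≤ r' x) ∧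
      (r' x = -1 ∨ ∃ y : Fin n, G.Adj x y ∧ r' x = r y)) : IsRow G D f (k + 1) r' := by
  refine ⟨fun x u p hp hl => ?_, fun x => ?_⟩
  · by_cases hx : x ∈ D
    · obtain rfl := hp.2 x (by simp) hx
      exact (h x hx).ge
    · cases p with
      | nil => exact absurd hp.1 hx
      | @cons _ y _ hxy p =>
        exact (hr.le p hp.of_cons (by simpa using hl)).trans ((h' x hx).1 y hxy)
  · by_cases hx : x ∈ D
    · exact Or.inr ⟨x, .nil, .nil hx, by simp, h x hx⟩
    · rcases (h' x hx).2 with h1 | ⟨y, hxy, h1⟩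
      · exact Or.inl h1
      · rcases hr.mem y with h2 | ⟨u, p, hp, hl, h2⟩
        · exact Or.inl (h1.trans h2)
        · exact Or.inr ⟨u, .cons hxy p, hp.cons hxy hx, by simpa using hl, h1.trans h2⟩

theorem holds_markTest {s : State} {x : Fin n} {a b : ℕ} (h : s.idxVar b = x) :
    (markTest a b).Holds s ↔ 1 ≤ s.idxArr a x 0 := by
  simp [markTest, Test.Holds, IdxExpr.eval, h]

theorem holds_adjTest {s : State} (hG : HasGraph G s) {a b : ℕ} {x y : Fin n}
    (h : s.idxVar a = x) (h' : s.idxVar b = y) : (adjTest a b).Holds s ↔ G.Adj x y := by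
  simp only [adjTest, Test.Holds, IdxExpr.eval, h, h']
  exact hG.adj x y

theorem eval_negOne (s : State) : negOne.eval s = -1 := by
  simp [negOne, RealExpr.eval]

variable {e : RealExpr} {a : ℕ}

/-- The expression `e` is the tone, or one minus the tone, of the vertex in variable 5. It may be
evaluated in any state with an intact current colouring, and `a ≠ 2` keeps the table from
overwriting that colouring. -/
theorem run_tableInit (s : State) (hG : HasGraph G s) (ha : a ≠ 2)
    (he : ∀ (t : State) (x : Fin n), t.realArr 2 = s.realArr 2 → t.idxVar 5 = (x : ℕ) →
      e.eval t = f x) :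
    IsRow G (coloured n s) f 0 (((tableInit e a).run s).realArr a 0) := by
  have key := run_forN_induction (i := 5)
    (p := ite (markTest 2 5) (setReal 1 e) (setReal 1 negOne) ;;
      storeReal a (.lit 0) (.var 5) (.var 1))
    (fun m t => ∀ x : Fin n, x < m → (x ∈ coloured n s → t.realArr a 0 x = f x) ∧
      (x ∉ coloured n s → t.realArr a 0 x = -1)) s (by simp) ?_
  · rw [hG.size] at key
    exact isRow_zero (fun x hx => (key x x.2).1 hx) fun x hx => (key x x.2).2 hx
  · intro k t hk hi hf ih x hx
    have h2 : t.idxArr 2 = s.idxArr 2 := hf.idxArr 2 (by simp)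
    have h3 : t.realArr 2 = s.realArr 2 := hf.realArr 2 (by simp [ha.symm])
    obtain ⟨z, rfl⟩ : ∃ z : Fin n, (z : ℕ) = k := ⟨⟨k, hG.size ▸ hk⟩, rfl⟩
    have hc : (markTest 2 5).Holds t ↔ z ∈ coloured n s := by
      rw [holds_markTest hi, h2]
      rfl
    by_cases hz : z ∈ coloured n s <;> by_cases hxz : x = z
    · subst hxz
      simp [run, hc, hz, RealExpr.eval, IdxExpr.eval, hi, he t x h3 hi]
    · have := Fin.val_ne_of_ne hxz
      simpa [run, hc, hz, RealExpr.eval, IdxExpr.eval, hi, Fin.val_inj, hxz]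
        using ih x (by omega)
    · subst hxz
      simp [run, hc, hz, RealExpr.eval, IdxExpr.eval, hi, eval_negOne]
    · have := Fin.val_ne_of_ne hxz
      simpa [run, hc, hz, RealExpr.eval, IdxExpr.eval, hi, Fin.val_inj, hxz]
        using ih x (by omega)

theorem run_maxLoop (s : State) (hG : HasGraph G s) {x : Fin n} (hx : s.idxVar 5 = (x : ℕ)) :
    let r := s.realArr a (s.idxVar 4)
    let v := ((forN 6 (maxStep a)).run s).realVar 1
    (∀ y : Fin n, G.Adj x y → r y ≤ v) ∧
      (v = s.realVar 1 ∨ ∃ y : Fin n, G.Adj x y ∧ v = r y) := by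
  intro r v
  have key := isMaxStep_forN (fun t => (t.realVar 1, ()))
    (fun k => {c | ∃ y : Fin n, (y : ℕ) = k ∧ G.Adj x y ∧ c = (r y, ())})
    (i := 6) (p := maxStep a) s (by simp) ?_
  · rw [hG.size] at key
    refine ⟨fun y hy => key.ub (r y, ()) ⟨y, y.2, y, rfl, hy, rfl⟩, ?_⟩
    rcases key.mem with h | ⟨k, -, y, -, hy, h⟩
    · exact Or.inl (congrArg Prod.fst h)
    · exact Or.inr ⟨y, hy, congrArg Prod.fst h⟩
  · intro k t hk hi hf
    obtain ⟨z, rfl⟩ : ∃ z : Fin n, (z : ℕ) = k := ⟨⟨k, hG.size ▸ hk⟩, rfl⟩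
    have h5 : t.idxVar 5 = (x : ℕ) := (hf.idxVar 5 (by simp [maxStep])).trans hx
    have h4 : t.idxVar 4 = s.idxVar 4 := hf.idxVar 4 (by simp [maxStep])
    have hr : t.realArr = s.realArr := funext fun b => hf.realArr b (by simp [maxStep])
    have hGt : HasGraph G t := hG.of_frame hf (by simp [maxStep]) (by simp [maxStep])
    rw [maxStep, run_ite, run_ite]
    have hev : (RealExpr.get a (.var 4) (.var 6)).eval t = r z := by
      simp [RealExpr.eval, IdxExpr.eval, hi, h4, hr, r]
    have hadj := holds_adjTest hGt h5 hi
    simp only [Test.Holds, hev]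
    split_ifs with h1 h2
    · refine .refl ?_
      rintro c ⟨y, hy, -, rfl⟩
      rwa [Fin.val_inj.1 hy]
    · have h2' : t.realVar 1 < r z := not_le.1 h2
      refine ⟨?_, ?_, Or.inr ⟨z, rfl, hadj.1 h1, ?_⟩⟩
      · simpa [run, hev] using h2'.le
      · rintro c ⟨y, hy, -, rfl⟩
        rw [Fin.val_inj.1 hy]
        simp [run, hev]
      · simp [run, hev]
    · refine .refl ?_
      rintro c ⟨y, hy, hxy, rfl⟩
      exact absurd (hadj.2 (Fin.val_inj.1 hy ▸ hxy)) h1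

theorem run_tableEntry (s : State) (hG : HasGraph G s)
    (he : ∀ (t : State) (x : Fin n), t.realArr 2 = s.realArr 2 → t.idxVar 5 = (x : ℕ) →
      e.eval t = f x) {x : Fin n} (hx : s.idxVar 5 = (x : ℕ)) :
    ∃ v, ((tableEntry e a).run s).realArr =
        updateArr s.realArr a (s.idxVar 4 + 1) x v ∧
      (x ∈ coloured n s → v = f x) ∧
      (x ∉ coloured n s → (∀ y : Fin n, G.Adj x y → s.realArr a (s.idxVar 4) y ≤ v) ∧
        (v = -1 ∨ ∃ y : Fin n, G.Adj x y ∧ v = s.realArr a (s.idxVar 4) y)) := by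
  set s₁ := s.setR 1 (-1) with hs₁
  set s₂ := (forN 6 (maxStep a)).run s₁ with hs₂
  have hf := frame_run (forN 6 (maxStep a)) s₁
  rw [← hs₂] at hf
  have hloop := run_maxLoop (a := a) s₁ (hG.of_eq rfl rfl) hx
  simp only at hloop
  rw [← hs₂] at hloop
  have h5 : s₂.idxVar 5 = (x : ℕ) := (hf.idxVar 5 (by simp [maxStep])).trans hx
  have h4 : s₂.idxVar 4 = s.idxVar 4 := hf.idxVar 4 (by simp [maxStep])
  have hr : s₂.realArr = s.realArr := funext fun b => hf.realArr b (by simp [maxStep])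
  have hi : s₂.idxArr 2 = s.idxArr 2 := hf.idxArr 2 (by simp [maxStep])
  have hc : (markTest 2 5).Holds s₂ ↔ x ∈ coloured n s := by
    rw [holds_markTest h5, hi]
    rfl
  have hrun : (tableEntry e a).run s = (storeReal a (.add (.var 4) (.lit 1)) (.var 5) (.var 1)).run
      ((ite (markTest 2 5) (setReal 1 e) skip).run s₂) := by
    simp only [tableEntry, run_seq, run_setReal, eval_negOne, hs₂, hs₁]
  rw [hrun]
  by_cases hxc : x ∈ coloured n s
  · refine ⟨f x, ?_, fun _ => rfl, fun h => absurd hxc h⟩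
    have he' := he s₂ x (by rw [hr]) h5
    simp only [run, hc, hxc, if_true, he']
    simp [State.storeR, RealExpr.eval, IdxExpr.eval, hr, h4, h5]
  · refine ⟨s₂.realVar 1, ?_, fun h => absurd h hxc, fun _ => hloop⟩
    simp only [run, hc, hxc, if_false]
    simp [State.storeR, RealExpr.eval, IdxExpr.eval, hr, h4, h5]

theorem run_tableRow (s : State) (hG : HasGraph G s) (ha : a ≠ 2)
    (he : ∀ (t : State) (x : Fin n), t.realArr 2 = s.realArr 2 → t.idxVar 5 = (x : ℕ) →
      e.eval t = f x) {k : ℕ} (hk : s.idxVar 4 = k)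
    (hr : IsRow G (coloured n s) f k (s.realArr a k)) :
    IsRow G (coloured n s) f (k + 1) (((forN 5 (tableEntry e a)).run s).realArr a (k + 1)) ∧
      ∀ j ≠ k + 1, ((forN 5 (tableEntry e a)).run s).realArr a j = s.realArr a j := by
  have key := run_forN_induction (i := 5) (p := tableEntry e a)
    (fun m t => (∀ j ≠ k + 1, t.realArr a j = s.realArr a j) ∧ ∀ x : Fin n, x < m →
      (x ∈ coloured n s → t.realArr a (k + 1) x = f x) ∧
      (x ∉ coloured n s → (∀ y : Fin n, G.Adj x y → s.realArr a k y ≤ t.realArr a (k + 1) x) ∧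
        (t.realArr a (k + 1) x = -1 ∨
          ∃ y : Fin n, G.Adj x y ∧ t.realArr a (k + 1) x = s.realArr a k y))) s (by simp) ?_
  · rw [hG.size] at key
    exact ⟨hr.succ (fun x hx => (key.2 x x.2).1 hx) fun x hx => (key.2 x x.2).2 hx, key.1⟩
  · rintro m t hm hi hf ⟨ih, ih'⟩
    have h2 : t.idxArr 2 = s.idxArr 2 := hf.idxArr 2 (by simp [tableEntry, maxStep])
    have h3 : t.realArr 2 = s.realArr 2 := hf.realArr 2 (by simp [tableEntry, maxStep, ha.symm])
    have h4 : t.idxVar 4 = k := (hf.idxVar 4 (by simp [tableEntry, maxStep])).trans hk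
    have hGt : HasGraph G t :=
      hG.of_frame hf (by simp [tableEntry, maxStep]) (by simp [tableEntry, maxStep])
    have hct : coloured n t = coloured n s := by
      unfold coloured
      rw [h2]
    obtain ⟨z, rfl⟩ : ∃ z : Fin n, (z : ℕ) = m := ⟨⟨m, hG.size ▸ hm⟩, rfl⟩
    obtain ⟨v, hv, hv1, hv2⟩ := run_tableEntry (f := f) t hGt
      (fun u x hu => he u x (hu.trans h3)) hi
    rw [h4, hct, ih k (by omega)] at hv2
    rw [hct] at hv1
    rw [h4] at hv
    constructor
    · intro j hj
      rw [← ih j hj, State.setI_realArr, hv]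
      funext y
      simp [updateArr, hj]
    · intro x hx
      rw [State.setI_realArr, hv]
      by_cases hxz : x = z
      · subst hxz
        simpa [updateArr] using ⟨hv1, hv2⟩
      · have : updateArr t.realArr a (k + 1) z v a (k + 1) x = t.realArr a (k + 1) x := by
          simp [updateArr, Fin.val_inj, hxz]
        rw [this]
        exact ih' x (by have := Fin.val_ne_of_ne hxz; omega)

theorem run_table (s : State) (hG : HasGraph G s) (ha : a ≠ 2)
    (he : ∀ (t : State) (x : Fin n), t.realArr 2 = s.realArr 2 → t.idxVar 5 = (x : ℕ) →
      e.eval t = f x) :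
    ∀ k ≤ n, IsRow G (coloured n s) f k (((table e a).run s).realArr a k) := by
  set s₁ := (tableInit e a).run s with hs₁
  have hf₁ := frame_run (tableInit e a) s
  rw [← hs₁] at hf₁
  have hG₁ : HasGraph G s₁ := hG.of_frame hf₁ (by simp [tableInit]) (by simp [tableInit])
  have hi₁ : s₁.idxArr 2 = s.idxArr 2 := hf₁.idxArr 2 (by simp [tableInit])
  have hr₁ : s₁.realArr 2 = s.realArr 2 := hf₁.realArr 2 (by simp [tableInit, ha.symm])
  have key := run_forN_induction (i := 4) (p := forN 5 (tableEntry e a))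
    (fun m t => ∀ k ≤ m, IsRow G (coloured n s) f k (t.realArr a k)) s₁ ?_ ?_
  · rw [hG₁.size] at key
    exact key
  · intro k hk
    obtain rfl : k = 0 := by omega
    exact run_tableInit s hG ha he
  · intro m t hm hi hf ih
    have h2 : t.idxArr 2 = s.idxArr 2 :=
      (hf.idxArr 2 (by simp [tableEntry, maxStep])).trans hi₁
    have h3 : t.realArr 2 = s.realArr 2 :=
      (hf.realArr 2 (by simp [tableEntry, maxStep, ha.symm])).trans hr₁
    have hGt : HasGraph G t :=
      hG₁.of_frame hf (by simp [tableEntry, maxStep]) (by simp [tableEntry, maxStep])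
    have hct : coloured n t = coloured n s := by
      unfold coloured
      rw [h2]
    obtain ⟨hrow, hrest⟩ := run_tableRow (f := f) t hGt ha
      (fun u x hu => he u x (hu.trans h3)) hi (by rw [hct]; exact ih m le_rfl)
    rw [hct] at hrow
    intro k hk
    rw [State.setI_realArr]
    by_cases hkm : k = m + 1
    · rw [hkm]
      exact hrow
    · rw [hrest k hkm]
      exact ih k (by omega)

end

end Code

end RealRAM

namespace RealRAM

namespace Code

/-! ## One round: colouring a vertex on a steepest path -/

/-- Compare the current candidate with the best one. -/
def searchStep : Code :=
  setReal 2 (.div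
    (.sub (.add (.get 3 (.add (.var 4) (.lit 1)) (.var 5)) (.get 4 (.add (.var 7) (.lit 1)) (.var 5)))
      (.lit 1))
    (.ofIdx (.add (.add (.var 4) (.lit 1)) (.add (.var 7) (.lit 1))))) ;;
  ite (.realLe (.var 2) (.var 3)) skip
    (setReal 3 (.var 2) ;; setIdx 8 (.var 5) ;;
      setReal 4 (.sub (.get 3 (.add (.var 4) (.lit 1)) (.var 5))
        (.mul (.var 2) (.ofIdx (.add (.var 4) (.lit 1))))))

/-- Search a vertex on a steepest path. -/
def search : Code :=
  -- The slope `-1` loses against the maximum, which is nonnegative if a vertex is uncoloured.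
  -- Otherwise the default stays, and the round harmlessly gives `w` its own tone again.
  setReal 3 negOne ;; setIdx 8 (.var 2) ;; setReal 4 (.var 0) ;;
    forN 5 (ite (markTest 2 5) skip (forN 4 (forN 7 searchStep)))

/-- The candidate that is given by the tables `r` and `r'`, a vertex and two lengths. -/
noncomputable def candidate (r r' : ℕ → ℕ → ℝ) (x j k : ℕ) : ℝ × ℕ × ℝ :=
  -- The table `r'` belongs to `1 - f`, so the numerator is a difference `f u - f u'`. The lengths
  -- start at 1 because exit walks from uncoloured vertices are not empty.
  ((r (j + 1) x + r' (k + 1) x - 1) / ((j + 1 + (k + 1) : ℕ) : ℝ), x, r (j + 1) x -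
    (r (j + 1) x + r' (k + 1) x - 1) / ((j + 1 + (k + 1) : ℕ) : ℝ) * ((j + 1 : ℕ) : ℝ))

/-- The best candidate so far. -/
def bestCandidate (s : State) : ℝ × ℕ × ℝ := (s.realVar 3, s.idxVar 8, s.realVar 4)

theorem run_searchStep (s : State) :
    IsMaxStep {candidate (s.realArr 3) (s.realArr 4) (s.idxVar 5) (s.idxVar 4) (s.idxVar 7)}
      (bestCandidate s) (bestCandidate (searchStep.run s)) := by
  set c := candidate (s.realArr 3) (s.realArr 4) (s.idxVar 5) (s.idxVar 4) (s.idxVar 7) with hc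
  rw [searchStep, run_seq, run_setReal]
  have h1 : (RealExpr.div
    (.sub (.add (.get 3 (.add (.var 4) (.lit 1)) (.var 5)) (.get 4 (.add (.var 7) (.lit 1)) (.var 5)))
      (.lit 1))
    (.ofIdx (.add (.add (.var 4) (.lit 1)) (.add (.var 7) (.lit 1))))).eval s = c.1 := by
    simp [RealExpr.eval, IdxExpr.eval, hc, candidate]
  rw [h1, run_ite]
  have h2 : (Test.realLe (.var 2) (.var 3)).Holds (s.setR 2 c.1) ↔ c.1 ≤ s.realVar 3 := by
    simp [Test.Holds, RealExpr.eval]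
  simp only [h2]
  split_ifs with h
  · have : bestCandidate (skip.run (s.setR 2 c.1)) = bestCandidate s := by
      simp [bestCandidate, run_skip]
    rw [this]
    exact .refl fun x hx => by rw [hx]; exact h
  · have : bestCandidate ((setReal 3 (.var 2) ;; setIdx 8 (.var 5) ;;
      setReal 4 (.sub (.get 3 (.add (.var 4) (.lit 1)) (.var 5))
        (.mul (.var 2) (.ofIdx (.add (.var 4) (.lit 1)))))).run (s.setR 2 c.1)) = c := by
      simp [bestCandidate, run_seq, run_setReal, run_setIdx, RealExpr.eval, IdxExpr.eval, hc,
        candidate]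
    rw [this]
    exact ⟨(not_le.1 h).le, fun x hx => by rw [hx], Or.inr rfl⟩

/-- One application of `isMaxStep_forN` for each of the three nested loops. -/
theorem run_search {n : ℕ} {G : SimpleGraph (Fin n)} (s : State) (hG : HasGraph G s) :
    IsMaxStep {c | ∃ x : Fin n, x ∉ coloured n s ∧ ∃ j < n, ∃ k < n,
        c = candidate (s.realArr 3) (s.realArr 4) x j k}
      (-1, s.idxVar 2, s.realVar 0) (bestCandidate (search.run s)) := by
  set s₁ := ((s.setR 3 (-1)).setI 8 (s.idxVar 2)).setR 4 (s.realVar 0) with hs₁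
  have hrun : search.run s =
      (forN 5 (ite (markTest 2 5) skip (forN 4 (forN 7 searchStep)))).run s₁ := by
    simp [search, run_seq, run_setReal, run_setIdx, eval_negOne, RealExpr.eval, IdxExpr.eval, hs₁]
  have hb : bestCandidate s₁ = (-1, s.idxVar 2, s.realVar 0) := by
    simp [bestCandidate, hs₁]
  have hG₁ : HasGraph G s₁ := hG.of_eq (by simp [hs₁]) (by simp [hs₁])
  rw [hrun, ← hb]
  have hπ : ∀ i, i ≠ 8 → ∀ (t : State) (v : ℕ),
      bestCandidate (t.setI i v) = bestCandidate t := by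
    intro i hi t v
    simp [bestCandidate, hi.symm]
  have key := isMaxStep_forN bestCandidate
    (fun m => {c | ∃ x : Fin n, (x : ℕ) = m ∧ x ∉ coloured n s ∧ ∃ j < n, ∃ k < n,
        c = candidate (s.realArr 3) (s.realArr 4) x j k}) (i := 5)
        (p := ite (markTest 2 5) skip (forN 4 (forN 7 searchStep))) s₁ (hπ 5 (by simp)) ?_
  · have : {c | ∃ x : Fin n, x ∉ coloured n s ∧ ∃ j < n, ∃ k < n,
        c = candidate (s.realArr 3) (s.realArr 4) x j k} = {c | ∃ m < s₁.idxVar 0,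
        c ∈ {c | ∃ x : Fin n, (x : ℕ) = m ∧ x ∉ coloured n s ∧ ∃ j < n, ∃ k < n,
        c = candidate (s.realArr 3) (s.realArr 4) x j k}} := by
      rw [hG₁.size]
      ext c
      constructor
      · rintro ⟨x, hx⟩
        exact ⟨x, x.2, x, rfl, hx⟩
      · rintro ⟨m, -, x, -, hx⟩
        exact ⟨x, hx⟩
    rw [this]
    exact key
  intro m t hm hi hf
  obtain ⟨z, rfl⟩ : ∃ z : Fin n, (z : ℕ) = m := ⟨⟨m, hG₁.size ▸ hm⟩, rfl⟩
  have hGt : HasGraph G t := hG₁.of_frame hf (by simp [searchStep]) (by simp [searchStep])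
  have hra : t.realArr = s.realArr := funext fun a => hf.realArr a (by simp [searchStep])
  have hc : (markTest 2 5).Holds t ↔ z ∈ coloured n s := by
    rw [holds_markTest hi, hf.idxArr 2 (by simp [searchStep])]
    rfl
  rw [run_ite]
  split_ifs with hz
  · refine .refl ?_
    rintro c ⟨x, hx, hxc, -⟩
    exact absurd (Fin.val_inj.1 hx ▸ hc.1 hz) hxc
  have key := isMaxStep_forN bestCandidate
    (fun j => {c | ∃ k < n, c = candidate (s.realArr 3) (s.realArr 4) z j k}) (i := 4)
        (p := forN 7 searchStep) t (hπ 4 (by simp)) ?_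
  · have : {c | ∃ x : Fin n, (x : ℕ) = z ∧ x ∉ coloured n s ∧ ∃ j < n, ∃ k < n,
        c = candidate (s.realArr 3) (s.realArr 4) x j k} = {c | ∃ j < t.idxVar 0,
        c ∈ {c | ∃ k < n, c = candidate (s.realArr 3) (s.realArr 4) z j k}} := by
      rw [hGt.size]
      ext c
      constructor
      · rintro ⟨x, hx, -, h⟩
        rw [Fin.val_inj.1 hx] at h
        exact h
      · exact fun h => ⟨z, rfl, fun h' => hz (hc.2 h'), h⟩
    rw [this]
    exact key
  intro j t₁ hj hi₁ hf₁
  have hGt₁ : HasGraph G t₁ := hGt.of_frame hf₁ (by simp [searchStep]) (by simp [searchStep])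
  have hra₁ : t₁.realArr = s.realArr :=
    (funext fun a => hf₁.realArr a (by simp [searchStep])).trans hra
  have h5 : t₁.idxVar 5 = z := (hf₁.idxVar 5 (by simp [searchStep])).trans hi
  have key := isMaxStep_forN bestCandidate
    (fun k => {candidate (s.realArr 3) (s.realArr 4) z j k}) (i := 7)
        (p := searchStep) t₁ (hπ 7 (by simp)) ?_
  · rw [hGt₁.size] at key
    exact key
  intro k t₂ hk hi₂ hf₂
  have hra₂ : t₂.realArr = s.realArr :=
    (funext fun a => hf₂.realArr a (by simp [searchStep])).trans hra₁
  have h5' : t₂.idxVar 5 = z := (hf₂.idxVar 5 (by simp [searchStep])).trans h5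
  have h4 : t₂.idxVar 4 = j := (hf₂.idxVar 4 (by simp [searchStep])).trans hi₁
  have := run_searchStep t₂
  rwa [hra₂, h5', h4, hi₂] at this

/-! ### From the winning candidate to a steepest pair of walks -/

section

open Greyscale

variable {n : ℕ} {G : SimpleGraph (Fin n)} {D : Set (Fin n)} {f : Fin n → ℝ}

/-- Every short pair is dominated by the candidate for its two lengths, so the winning slope bounds
all slopes. Being nonnegative, it must come from actual walks rather than from an entry `-1`. -/
theorem exists_isSteepest_of_isMaxStep (hG : G.Connected) (hD : D.Nonempty) (hD' : D ≠ Set.univ)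
    (hf : ∀ v ∈ D, f v ∈ Set.Icc (0 : ℝ) 1) {r r' : ℕ → ℕ → ℝ}
    (hr : ∀ k ≤ n, IsRow G D f k (r k)) (hr' : ∀ k ≤ n, IsRow G D (fun v => 1 - f v) k (r' k))
    {a : ℕ × ℝ} {b : ℝ × ℕ × ℝ}
    (h : IsMaxStep {c | ∃ x : Fin n, x ∉ D ∧ ∃ j < n, ∃ k < n, c = candidate r r' x j k}
      (-1, a) b) : ∃ v : Fin n, b.2.1 = v ∧ IsSteepest G D f v b.2.2 := by
  have hshort : ∀ {x u u' : Fin n} (p : G.Walk x u) (q : G.Walk x u'), x ∉ D → IsExit D p →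
      IsExit D q → p.length < n → q.length < n → f u - f u' ≤ b.1 * (p.length + q.length) := by
    intro x u u' p q hx hp hq hlp hlq
    have hp0 := hp.length_pos hx
    have hq0 := hq.length_pos hx
    have h1 := (hr p.length hlp.le).le p hp le_rfl
    have h2 := (hr' q.length hlq.le).le q hq le_rfl
    have h3 := h.ub _ ⟨x, hx, p.length - 1, by omega, q.length - 1, by omega, rfl⟩
    rw [candidate, Nat.sub_add_cancel hp0, Nat.sub_add_cancel hq0] at h3
    have h4 : (0 : ℝ) < ((p.length + q.length : ℕ) : ℝ) := by
      exact_mod_cast Nat.add_pos_left hp0 _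
    rw [div_le_iff₀ h4] at h3
    push_cast at h3
    linarith
  obtain ⟨x₀, hx₀⟩ := (Set.ne_univ_iff_exists_notMem D).1 hD'
  obtain ⟨u₀, q₀, hq₀⟩ := exists_isExit hG hD x₀
  have hs0 : 0 ≤ b.1 := by
    obtain ⟨p', hp', -, hlt⟩ := hq₀.exists_short
    rw [Fintype.card_fin] at hlt
    have h1 := hshort p' p' hx₀ hp' hp' hlt hlt
    have h2 : (0 : ℝ) < p'.length := by exact_mod_cast hp'.length_pos hx₀
    rw [sub_self] at h1
    by_contra hs
    nlinarith
  have hslope : SlopeLE G D f b.1 := by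
    intro x u u' p q hx hp hq
    obtain ⟨p', hp', hle, hlt⟩ := hp.exists_short
    obtain ⟨q', hq', hle', hlt'⟩ := hq.exists_short
    rw [Fintype.card_fin] at hlt hlt'
    refine (hshort p' q' hx hp' hq' hlt hlt').trans (mul_le_mul_of_nonneg_left ?_ hs0)
    exact_mod_cast Nat.add_le_add hle hle'
  rcases h.mem with rfl | ⟨x, hx, j, hj, k, hk, hb⟩
  · norm_num at hs0
  have hpos : (0 : ℝ) < ((j + 1 + (k + 1) : ℕ) : ℝ) := by positivity
  have hb1 : b.1 = (r (j + 1) x + r' (k + 1) x - 1) / ((j + 1 + (k + 1) : ℕ) : ℝ) := by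
    rw [hb, candidate]
  have hb2 : b.2.2 = r (j + 1) x - b.1 * ((j + 1 : ℕ) : ℝ) := by
    rw [hb, candidate]
  have hnum : r (j + 1) x + r' (k + 1) x - 1 = b.1 * ((j + 1 + (k + 1) : ℕ) : ℝ) := by
    rw [hb1, div_mul_cancel₀ _ hpos.ne']
  have hnum0 : 0 ≤ r (j + 1) x + r' (k + 1) x - 1 := by
    rw [hnum]
    positivity
  refine ⟨x, by rw [hb, candidate], hx, b.1, hslope, ?_⟩
  -- The entries are at most 1 since the tones lie in `[0,1]`; so one entry `-1` would make the
  -- numerator negative.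
  rcases (hr (j + 1) (by omega)).mem x with h1 | ⟨u, p, hp, hlp, h1⟩
  · rcases (hr' (k + 1) (by omega)).mem x with h2 | ⟨u', q, hq, hlq, h2⟩
    · linarith
    · have := (hf u' hq.1).1
      linarith
  · rcases (hr' (k + 1) (by omega)).mem x with h2 | ⟨u', q, hq, hlq, h2⟩
    · have := (hf u hp.1).2
      linarith
    · refine ⟨u, u', p, q, hp, hq, ?_⟩
      -- The walks may be shorter than `j + 1` and `k + 1`. But the winning slope times the nominal
      -- lengths is `f u - f u'`, which the slope bound limits by the true lengths, so both products
      -- agree.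
      have h3 := hslope p q hx hp hq
      have h4 : b.1 * (p.length : ℝ) ≤ b.1 * ((j + 1 : ℕ) : ℝ) :=
        mul_le_mul_of_nonneg_left (by exact_mod_cast hlp) hs0
      have h5 : b.1 * (q.length : ℝ) ≤ b.1 * ((k + 1 : ℕ) : ℝ) :=
        mul_le_mul_of_nonneg_left (by exact_mod_cast hlq) hs0
      rw [Nat.cast_add (j + 1) (k + 1)] at hnum
      rw [mul_add] at hnum h3
      constructor <;> linarith

end

/-- Colour one more vertex. -/
def round : Code :=
  table (.get 2 (.var 5) (.lit 0)) 3 ;; table (.sub (.lit 1) (.get 2 (.var 5) (.lit 0))) 4 ;;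
    search ;; storeIdx 2 (.var 8) (.lit 0) (.lit 1) ;; storeReal 2 (.var 8) (.lit 0) (.var 4)

/-- The number of rounds is fixed in advance, so a round must also be idle once all vertices are
coloured; `hwc` serves this case. -/
theorem run_round {n : ℕ} {G : SimpleGraph (Fin n)} (hc : G.Connected) (s : State)
    (hG : HasGraph G s) {w : Fin n} (hw : s.idxVar 2 = (w : ℕ)) (hwD : w ∈ coloured n s)
    (hwc : colouring n s w = s.realVar 0)
    (hf : ∀ v ∈ coloured n s, colouring n s v ∈ Set.Icc (0 : ℝ) 1) :
    ∃ (v : Fin n) (y : ℝ), coloured n (round.run s) = insert v (coloured n s) ∧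
      colouring n (round.run s) = Function.update (colouring n s) v y ∧
      (coloured n s ≠ Set.univ → Greyscale.IsSteepest G (coloured n s) (colouring n s) v y) ∧
      (coloured n s = Set.univ → colouring n (round.run s) = colouring n s) := by
  set e : RealExpr := .get 2 (.var 5) (.lit 0) with he
  set e' : RealExpr := .sub (.lit 1) (.get 2 (.var 5) (.lit 0)) with he'
  set s₁ := (table e 3).run s with hs₁
  set s₂ := (table e' 4).run s₁ with hs₂
  set s₃ := search.run s₂ with hs₃
  have hf₁ := frame_run (table e 3) s
  have hf₂ := frame_run (table e' 4) s₁
  have hf₃ := frame_run search s₂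
  rw [← hs₁] at hf₁
  rw [← hs₂] at hf₂
  rw [← hs₃] at hf₃
  have hG₁ : HasGraph G s₁ := hG.of_frame hf₁ (by simp [table, tableInit, tableEntry, maxStep])
    (by simp [table, tableInit, tableEntry, maxStep])
  have hG₂ : HasGraph G s₂ := hG₁.of_frame hf₂ (by simp [table, tableInit, tableEntry, maxStep])
    (by simp [table, tableInit, tableEntry, maxStep])
  have hi₁ : s₁.idxArr 2 = s.idxArr 2 :=
    hf₁.idxArr 2 (by simp [table, tableInit, tableEntry, maxStep])
  have hr₁ : s₁.realArr 2 = s.realArr 2 :=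
    hf₁.realArr 2 (by simp [table, tableInit, tableEntry, maxStep])
  have hi₂ : s₂.idxArr 2 = s.idxArr 2 :=
    (hf₂.idxArr 2 (by simp [table, tableInit, tableEntry, maxStep])).trans hi₁
  have hr₂ : s₂.realArr 2 = s.realArr 2 :=
    (hf₂.realArr 2 (by simp [table, tableInit, tableEntry, maxStep])).trans hr₁
  have hi₃ : s₃.idxArr 2 = s.idxArr 2 := (hf₃.idxArr 2 (by simp [search, searchStep])).trans hi₂
  have hr₃ : s₃.realArr 2 = s.realArr 2 := (hf₃.realArr 2 (by simp [search, searchStep])).trans hr₂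
  have h3 : s₂.realArr 3 = s₁.realArr 3 :=
    hf₂.realArr 3 (by simp [table, tableInit, tableEntry, maxStep])
  have hw₂ : s₂.idxVar 2 = (w : ℕ) :=
    (hf₂.idxVar 2 (by simp [table, tableInit, tableEntry, maxStep])).trans
      ((hf₁.idxVar 2 (by simp [table, tableInit, tableEntry, maxStep])).trans hw)
  have hc₂ : s₂.realVar 0 = s.realVar 0 :=
    (hf₂.realVar 0 (by simp [table, tableInit, tableEntry, maxStep])).trans
      (hf₁.realVar 0 (by simp [table, tableInit, tableEntry, maxStep]))
  have hD₁ : coloured n s₁ = coloured n s := by unfold coloured; rw [hi₁]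
  have hD₂ : coloured n s₂ = coloured n s := by unfold coloured; rw [hi₂]
  have hrow : ∀ k ≤ n, IsRow G (coloured n s) (colouring n s) k (s₂.realArr 3 k) := by
    rw [h3]
    exact run_table s hG (by simp) fun t x ht hx => by
      simp [he, RealExpr.eval, IdxExpr.eval, hx, ht, colouring]
  have hrow' : ∀ k ≤ n, IsRow G (coloured n s) (fun v => 1 - colouring n s v) k
      (s₂.realArr 4 k) := by
    rw [← hD₁]
    exact run_table s₁ hG₁ (by simp) fun t x ht hx => by
      simp [he', RealExpr.eval, IdxExpr.eval, hx, ht, hr₁, colouring]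
  have hsearch := run_search s₂ hG₂
  rw [← hs₃, hD₂, hw₂, hc₂] at hsearch
  have hrun : round.run s = (s₃.storeI 2 (s₃.idxVar 8) 0 1).storeR 2 (s₃.idxVar 8) 0
      (s₃.realVar 4) := by
    simp only [round, run_seq, run_storeIdx, run_storeReal, RealExpr.eval, IdxExpr.eval, hs₃,
      hs₂, hs₁]
    rfl
  have hcol : ∀ v : Fin n, s₃.idxVar 8 = (v : ℕ) →
      coloured n (round.run s) = insert v (coloured n s) ∧
      colouring n (round.run s) = Function.update (colouring n s) v (s₃.realVar 4) := by
    intro v hv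
    rw [hrun, hv]
    constructor
    · ext x
      by_cases hxv : x = v
      · simp [coloured, hxv]
      · simp [coloured, hxv, Fin.val_inj, hi₃]
    · funext x
      by_cases hxv : x = v
      · simp [colouring, hxv]
      · simp [colouring, hxv, Fin.val_inj, hr₃]
  by_cases hu : coloured n s = Set.univ
  · have hb : bestCandidate s₃ = (-1, (w : ℕ), s.realVar 0) := by
      rcases hsearch.mem with h | ⟨x, hx, -⟩
      · exact h
      · rw [hu] at hx
        exact absurd (Set.mem_univ x) hx
    simp only [bestCandidate, Prod.mk.injEq] at hb
    obtain ⟨h1, h2⟩ := hcol w hb.2.1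
    refine ⟨w, _, h1, h2, fun h => absurd hu h, fun _ => ?_⟩
    rw [h2, hb.2.2, ← hwc, Function.update_eq_self]
  · obtain ⟨v, hv, hst⟩ := exists_isSteepest_of_isMaxStep hc ⟨w, hwD⟩ hu hf hrow hrow' hsearch
    obtain ⟨h1, h2⟩ := hcol v hv
    exact ⟨v, _, h1, h2, fun _ => hst, fun h => absurd h hu⟩

/-! ## The best extension -/

/-- Copy the given colouring and give the tone in the real variable `0` to the vertex in the
index variable `2`. -/
def initColouring : Code :=
  forN 5 (storeIdx 2 (.var 5) (.lit 0) (.get 1 (.var 5) (.lit 0)) ;;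
    storeReal 2 (.var 5) (.lit 0) (.get 0 (.var 5) (.lit 0))) ;;
  storeIdx 2 (.var 2) (.lit 0) (.lit 1) ;; storeReal 2 (.var 2) (.lit 0) (.var 0)

/-- Compute the best extension. -/
def solve : Code := initColouring ;; forN 3 round

/-- The set of the vertices that are coloured in the input. -/
def inputColoured (n : ℕ) (s : State) : Set (Fin n) := {i | 1 ≤ s.idxArr 1 i 0}

/-- The colouring in the input. -/
def inputColouring (n : ℕ) (s : State) : Fin n → ℝ := fun i => s.realArr 0 i 0

theorem run_initColouring {n : ℕ} (s : State) (hn : s.idxVar 0 = n) {w : Fin n}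
    (hw : s.idxVar 2 = (w : ℕ)) :
    coloured n (initColouring.run s) = insert w (inputColoured n s) ∧
      colouring n (initColouring.run s) =
        Function.update (inputColouring n s) w (s.realVar 0) := by
  set p : Code := storeIdx 2 (.var 5) (.lit 0) (.get 1 (.var 5) (.lit 0)) ;;
    storeReal 2 (.var 5) (.lit 0) (.get 0 (.var 5) (.lit 0)) with hp
  set s₁ := (forN 5 p).run s with hs₁
  have hf := frame_run (forN 5 p) s
  rw [← hs₁] at hf
  have hrun : initColouring.run s =
      (s₁.storeI 2 (s₁.idxVar 2) 0 1).storeR 2 (s₁.idxVar 2) 0 (s₁.realVar 0) := by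
    simp only [initColouring, run_seq, run_storeIdx, run_storeReal, RealExpr.eval, IdxExpr.eval,
      hs₁, hp]
    rfl
  have key := run_forN_induction (i := 5) (p := p) (fun m t => ∀ x : Fin n, (x : ℕ) < m →
    t.idxArr 2 x 0 = s.idxArr 1 x 0 ∧ t.realArr 2 x 0 = s.realArr 0 x 0) s (by simp) ?_
  · rw [hn] at key
    rw [hrun, hf.idxVar 2 (by simp [hp]), hw, hf.realVar 0 (by simp [hp])]
    constructor
    · ext x
      by_cases hxv : x = w
      · simp [coloured, hxv]
      · simp [coloured, inputColoured, hxv, Fin.val_inj, (key x x.2).1, hs₁]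
    · funext x
      by_cases hxv : x = w
      · simp [colouring, hxv]
      · simp [colouring, inputColouring, hxv, Fin.val_inj, (key x x.2).2, hs₁]
  · intro m t hm hi hft ih x hx
    have h1 : t.idxArr 1 = s.idxArr 1 := hft.idxArr 1 (by simp [hp])
    have h2 : t.realArr 0 = s.realArr 0 := hft.realArr 0 (by simp [hp])
    by_cases hxm : (x : ℕ) = m
    · simp [hp, run_seq, run_storeIdx, run_storeReal, RealExpr.eval, IdxExpr.eval, hi, hxm, h1, h2]
    · have := ih x (by omega)
      simpa [hp, run_seq, run_storeIdx, run_storeReal, RealExpr.eval, IdxExpr.eval, hi, hxm]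
        using this

/-- By `IsSteepest.bestExt_insert` the best extension of the current partial colouring is the same
in every round; when all vertices are coloured, it is the current colouring. -/
theorem run_solve {n : ℕ} {G : SimpleGraph (Fin n)} (hc : G.Connected) (s : State)
    (hG : HasGraph G s) {w : Fin n} (hw : s.idxVar 2 = (w : ℕ))
    (hc01 : s.realVar 0 ∈ Set.Icc (0 : ℝ) 1)
    (hf : ∀ v ∈ inputColoured n s, inputColouring n s v ∈ Set.Icc (0 : ℝ) 1) :
    colouring n (solve.run s) =
      Greyscale.bestExt hc (Set.insert_nonempty w (inputColoured n s))
        (Function.update (inputColouring n s) w (s.realVar 0)) := by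
  obtain ⟨hD, hcol⟩ := run_initColouring s hG.size hw
  set s₁ := initColouring.run s with hs₁
  set F := Greyscale.bestExt hc (Set.insert_nonempty w (inputColoured n s))
        (Function.update (inputColouring n s) w (s.realVar 0)) with hF
  have hf₁ := frame_run initColouring s
  rw [← hs₁] at hf₁
  have hG₁ : HasGraph G s₁ := hG.of_frame hf₁ (by simp [initColouring]) (by simp [initColouring])
  have hw₁ : s₁.idxVar 2 = (w : ℕ) := (hf₁.idxVar 2 (by simp [initColouring])).trans hw
  have hc₁ : s₁.realVar 0 = s.realVar 0 := hf₁.realVar 0 (by simp [initColouring])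
  -- The count starts with `w`, hence `m + 1` coloured vertices after `m` rounds unless the
  -- colouring is complete.
  have key := run_forN_induction (i := 3) (p := round) (fun m t => w ∈ coloured n t ∧
    colouring n t w = s.realVar 0 ∧
    (∀ v ∈ coloured n t, colouring n t v ∈ Set.Icc (0 : ℝ) 1) ∧
    (∃ h : (coloured n t).Nonempty, Greyscale.bestExt hc h (colouring n t) = F) ∧
    (coloured n t = Set.univ ∨ m + 1 ≤ (coloured n t).ncard)) s₁ ?_ ?_
  · obtain ⟨-, -, -, ⟨hne, h⟩, hu⟩ := key
    have hu' : coloured n ((forN 3 round).run s₁) = Set.univ := by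
      -- After `n` rounds there would be `n + 1` coloured vertices.
      refine hu.resolve_right fun hle => ?_
      have := Set.ncard_le_card (coloured n ((forN 3 round).run s₁))
      rw [Nat.card_fin] at this
      rw [hG₁.size] at hle
      omega
    change colouring n ((forN 3 round).run s₁) = F
    rw [← h]
    funext v
    rw [Greyscale.bestExt_eq hc hne (by rw [hu']; exact Set.mem_univ v)]
  · change w ∈ coloured n s₁ ∧ colouring n s₁ w = s.realVar 0 ∧
      (∀ v ∈ coloured n s₁, colouring n s₁ v ∈ Set.Icc (0 : ℝ) 1) ∧
      (∃ h : (coloured n s₁).Nonempty, Greyscale.bestExt hc h (colouring n s₁) = F) ∧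
      (coloured n s₁ = Set.univ ∨ 0 + 1 ≤ (coloured n s₁).ncard)
    rw [hD, hcol]
    refine ⟨Set.mem_insert _ _, Function.update_self .., fun v hv => ?_,
      ⟨Set.insert_nonempty _ _, rfl⟩, Or.inr ?_⟩
    · by_cases hvw : v = w
      · rw [hvw, Function.update_self]
        exact hc01
      · rw [Function.update_of_ne hvw]
        exact hf v (Set.mem_of_mem_insert_of_ne hv hvw)
    · rw [zero_add, Nat.succ_le_iff, Set.ncard_pos]
      exact Set.insert_nonempty _ _
  · rintro m t hm hi hft ⟨i1, i2, i3, ⟨hne, i4⟩, i5⟩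
    have hGt : HasGraph G t := hG₁.of_frame hft
      (by simp [round, search, searchStep, table, tableInit, tableEntry, maxStep])
      (by simp [round, search, searchStep, table, tableInit, tableEntry, maxStep])
    have hct : t.realVar 0 = s.realVar 0 := (hft.realVar 0
      (by simp [round, search, searchStep, table, tableInit, tableEntry, maxStep])).trans hc₁
    have hwt : t.idxVar 2 = (w : ℕ) := (hft.idxVar 2
      (by simp [round, search, searchStep, table, tableInit, tableEntry, maxStep])).trans hw₁
    obtain ⟨v, y, h1, h2, h3, h4⟩ := run_round hc t hGt hwt i1 (i2.trans hct.symm) i3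
    change w ∈ coloured n (round.run t) ∧ colouring n (round.run t) w = s.realVar 0 ∧
      (∀ v ∈ coloured n (round.run t), colouring n (round.run t) v ∈ Set.Icc (0 : ℝ) 1) ∧
      (∃ h : (coloured n (round.run t)).Nonempty,
        Greyscale.bestExt hc h (colouring n (round.run t)) = F) ∧
      (coloured n (round.run t) = Set.univ ∨ m + 1 + 1 ≤ (coloured n (round.run t)).ncard)
    by_cases hu : coloured n t = Set.univ
    · have : coloured n (round.run t) = coloured n t := by
        rw [h1, hu, Set.insert_eq_of_mem (Set.mem_univ v)]
      rw [this, h4 hu]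
      exact ⟨i1, i2, i3, ⟨hne, i4⟩, Or.inl hu⟩
    · have hst := h3 hu
      have hne' : ∀ z ∈ coloured n t, z ≠ v := by
        rintro z hz rfl
        exact hst.1 hz
      rw [h1, h2]
      refine ⟨Set.mem_insert_of_mem _ i1, ?_, fun z hz => ?_, ⟨Set.insert_nonempty _ _, ?_⟩,
        Or.inr ?_⟩
      · rw [Function.update_of_ne (hne' w i1), i2]
      · rcases hz with rfl | hz
        · rw [Function.update_self]
          exact hst.mem_Icc i3
        · rw [Function.update_of_ne (hne' z hz)]
          exact i3 z hz
      · rw [← i4]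
        exact hst.bestExt_insert hc hne
      · rw [Set.ncard_insert_of_notMem hst.1]
        have := i5.resolve_left hu
        omega

end Code

end RealRAM

/-! ### Multiplicities of tones as double sums -/

namespace Greyscale

open Classical in
-- The double sum matches the nested loops of `count`. It is taken in `ℝ` because differences of
-- multiplicities can be negative, while subtraction of indices is truncated.
theorem toneCount_eq_sum {n : ℕ} (G : SimpleGraph (Fin n)) (f : Fin n → ℝ) (t : ℝ) :
    (toneCount G f t : ℝ) =
      ∑ i : Fin n, ∑ j : Fin n, if G.Adj i j ∧ |f i - f j| = t then (1 : ℝ) else 0 := by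
  rw [toneCount, Finset.card_filter, Fintype.sum_prod_type]
  push_cast
  rfl

theorem exists_of_toneCount_ne_zero {V : Type*} [Fintype V] {G : SimpleGraph V} {f : V → ℝ}
    {t : ℝ} (h : toneCount G f t ≠ 0) : ∃ x y, G.Adj x y ∧ |f x - f y| = t := by
  obtain ⟨p, hp⟩ := Finset.card_ne_zero.1 h
  exact ⟨p.1, p.2, by simpa using hp⟩

end Greyscale

namespace RealRAM

namespace Code

/-! ## Comparison of two colourings -/

/-- The tone of the vertex in the index variable `x` in the new colouring. -/
def newAt (x : ℕ) : RealExpr := .get 2 (.var x) (.lit 0)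

/-- The tone of the vertex in the index variable `x` in the first colouring of the list. -/
def bestAt (x : ℕ) : RealExpr := .get 1 (.lit 0) (.var x)

/-- The absolute value of a difference. -/
def absSub (x : ℕ) (e₁ e₂ : RealExpr) : Code :=
  ite (.realLe e₁ e₂) (setReal x (.sub e₂ e₁)) (setReal x (.sub e₁ e₂))

/-- Equality of real numbers. -/
def eqTest (e₁ e₂ : RealExpr) : Test := .and (.realLe e₁ e₂) (.realLe e₂ e₁)

theorem run_absSub (x : ℕ) (e₁ e₂ : RealExpr) (s : State) :
    (absSub x e₁ e₂).run s = s.setR x |e₁.eval s - e₂.eval s| := by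
  rw [absSub, run_ite]
  split_ifs with h
  · rw [run_setReal, abs_of_nonpos (sub_nonpos.2 h), neg_sub]
    rfl
  · rw [run_setReal, abs_of_nonneg (sub_nonneg.2 (not_le.1 h).le)]
    rfl

theorem holds_eqTest {e₁ e₂ : RealExpr} {s : State} :
    (eqTest e₁ e₂).Holds s ↔ e₁.eval s = e₂.eval s := by
  simp only [eqTest, Test.Holds]
  exact le_antisymm_iff.symm

/-- Count an edge for the two colourings. -/
def countStep : Code :=
  ite (adjTest 7 9)
    (absSub 6 (newAt 7) (newAt 9) ;;
      ite (eqTest (.var 6) (.var 5)) (setReal 9 (.add (.var 9) (.lit 1))) skip ;;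
      absSub 6 (bestAt 7) (bestAt 9) ;;
      ite (eqTest (.var 6) (.var 5)) (setReal 9 (.sub (.var 9) (.lit 1))) skip) skip

/-- The difference of the multiplicities of a tone. -/
def count : Code := setReal 9 (.lit 0) ;; forN 7 (forN 9 countStep)

/-- The first colouring of the list. -/
def firstOutput (n : ℕ) (s : State) : Fin n → ℝ := fun i => s.realArr 1 0 i

open Classical in
/-- The contribution of an edge to the difference of the multiplicities. -/
noncomputable def countTerm (s : State) (i j : ℕ) : ℝ :=
  if 1 ≤ s.idxArr 0 i j then
    (if |s.realArr 2 i 0 - s.realArr 2 j 0| = s.realVar 5 then 1 else 0) -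
      (if |s.realArr 1 0 i - s.realArr 1 0 j| = s.realVar 5 then 1 else 0)
  else 0

theorem run_countStep (s : State) :
    (countStep.run s).realVar 9 = s.realVar 9 + countTerm s (s.idxVar 7) (s.idxVar 9) := by
  rw [countStep, run_ite, countTerm]
  have hadj : (adjTest 7 9).Holds s ↔ 1 ≤ s.idxArr 0 (s.idxVar 7) (s.idxVar 9) := by
    simp [adjTest, Test.Holds, IdxExpr.eval]
  by_cases h : 1 ≤ s.idxArr 0 (s.idxVar 7) (s.idxVar 9)
  · rw [if_pos (hadj.2 h), if_pos h]
    simp only [run_seq, run_ite, run_absSub, holds_eqTest]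
    by_cases h1 : |s.realArr 2 (s.idxVar 7) 0 - s.realArr 2 (s.idxVar 9) 0| = s.realVar 5 <;>
    by_cases h2 : |s.realArr 1 0 (s.idxVar 7) - s.realArr 1 0 (s.idxVar 9)| = s.realVar 5 <;>
    simp [newAt, bestAt, RealExpr.eval, IdxExpr.eval, h1, h2, run_setReal, run_skip]
    ring
  · rw [if_neg (hadj.not.2 h), if_neg h, run_skip, add_zero]

/-- The difference of the multiplicities of a tone in the new colouring and in the first
colouring of the list. -/
noncomputable def countDiff {n : ℕ} (G : SimpleGraph (Fin n)) (s : State) (t : ℝ) : ℝ :=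
  (Greyscale.toneCount G (colouring n s) t : ℝ) - Greyscale.toneCount G (firstOutput n s) t

variable {n : ℕ} {G : SimpleGraph (Fin n)}

theorem run_count (s : State) (hG : HasGraph G s) :
    (count.run s).realVar 9 = countDiff G s (s.realVar 5) := by
  classical
  set s₁ := s.setR 9 0 with hs₁
  have hrun : count.run s = (forN 7 (forN 9 countStep)).run s₁ := by
    simp [count, run_seq, run_setReal, RealExpr.eval, hs₁]
  have hterm : ∀ t : State, t.idxArr 0 = s.idxArr 0 → t.realArr = s.realArr →
      t.realVar 5 = s.realVar 5 → countTerm t = countTerm s := by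
    intro t h1 h2 h3
    unfold countTerm
    rw [h1, h2, h3]
  have key := sum_forN (fun t => t.realVar 9)
    (fun i => ∑ j ∈ Finset.range n, countTerm s i j) (i := 7) (p := forN 9 countStep) s₁
    (by simp) ?_
  · have hs0 : s₁.realVar 9 = 0 := by simp [hs₁]
    have hsz : s₁.idxVar 0 = n := hG.size
    rw [hrun, key, hs0, zero_add, hsz, countDiff, Greyscale.toneCount_eq_sum,
      Greyscale.toneCount_eq_sum, ← Finset.sum_sub_distrib, Finset.sum_range]
    refine Finset.sum_congr rfl fun i _ => ?_
    rw [← Finset.sum_sub_distrib, Finset.sum_range]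
    refine Finset.sum_congr rfl fun j _ => ?_
    simp only [countTerm, hG.adj, colouring, firstOutput]
    by_cases h : G.Adj i j <;> simp [h]
  · intro i t hi hi' hf
    have hi0 : t.idxArr 0 = s.idxArr 0 := hf.idxArr 0 (by simp [countStep, absSub])
    have hr : t.realArr = s.realArr := funext fun a => hf.realArr a (by simp [countStep, absSub])
    have h5 : t.realVar 5 = s.realVar 5 :=
      (hf.realVar 5 (by simp [countStep, absSub])).trans (by simp [hs₁])
    have hsz : t.idxVar 0 = n := (hf.idxVar 0 (by simp [countStep, absSub])).trans hG.size
    rw [sum_forN (fun t => t.realVar 9) (fun j => countTerm s i j) t (by simp), hsz]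
    intro j u hj hj' hfu
    have h7 : u.idxVar 7 = i := (hfu.idxVar 7 (by simp [countStep, absSub])).trans hi'
    rw [run_countStep, h7, hj', hterm u]
    · exact (hfu.idxArr 0 (by simp [countStep, absSub])).trans hi0
    · exact (funext fun a => hfu.realArr a (by simp [countStep, absSub])).trans hr
    · exact (hfu.realVar 5 (by simp [countStep, absSub])).trans h5

/-- Update the highest tone with different multiplicities. -/
def check : Code :=
  count ;; ite (.and (.not (eqTest (.var 9) (.lit 0))) (.not (.realLe (.var 5) (.var 7))))
    (setReal 7 (.var 5) ;; setReal 8 (.var 9)) skip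

/-- The highest tone with different multiplicities so far. -/
def topTone (s : State) : ℝ × ℝ := (s.realVar 7, s.realVar 8)

theorem run_check (s : State) (hG : HasGraph G s) :
    IsMaxStep {c | countDiff G s (s.realVar 5) ≠ 0 ∧
      c = (s.realVar 5, countDiff G s (s.realVar 5))} (topTone s) (topTone (check.run s)) := by
  have hf := frame_run count s
  have h9 := run_count s hG
  set s₁ := count.run s with hs₁
  have h5 : s₁.realVar 5 = s.realVar 5 := hf.realVar 5 (by simp [count, countStep, absSub])
  have h7 : s₁.realVar 7 = s.realVar 7 := hf.realVar 7 (by simp [count, countStep, absSub])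
  have h8 : s₁.realVar 8 = s.realVar 8 := hf.realVar 8 (by simp [count, countStep, absSub])
  have htop : topTone s₁ = topTone s := by rw [topTone, topTone, h7, h8]
  rw [check, run_seq, run_ite, ← hs₁]
  split_ifs with h
  · simp only [Test.Holds, holds_eqTest, RealExpr.eval, h9, h5, h7, Nat.cast_zero, not_le] at h
    have : topTone ((setReal 7 (.var 5) ;; setReal 8 (.var 9)).run s₁) =
        (s.realVar 5, countDiff G s (s.realVar 5)) := by
      simp [topTone, run_seq, run_setReal, RealExpr.eval, h5, h9]
    rw [this]
    refine ⟨h.2.le, ?_, Or.inr ⟨h.1, rfl⟩⟩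
    rintro c ⟨-, rfl⟩
    exact le_rfl
  · simp only [Test.Holds, holds_eqTest, RealExpr.eval, h9, h5, h7, Nat.cast_zero, not_and,
      not_not] at h
    rw [run_skip, htop]
    refine .refl ?_
    rintro c ⟨hd, rfl⟩
    exact h hd

/-- Treat the tones of an edge in the two colourings. -/
def compareStep : Code :=
  ite (adjTest 5 6)
    ((absSub 5 (newAt 5) (newAt 6) ;; check) ;; absSub 5 (bestAt 5) (bestAt 6) ;; check) skip

/-- Find the highest tone with different multiplicities in the two colourings. -/
def compare : Code :=
  setReal 7 negOne ;; setReal 8 (.lit 0) ;; forN 5 (forN 6 compareStep)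

theorem countDiff_congr {s t : State} (h : t.realArr = s.realArr) :
    countDiff G t = countDiff G s := by
  unfold countDiff colouring firstOutput
  rw [h]

theorem run_compareStep (s : State) (hG : HasGraph G s) {x y : Fin n}
    (hx : s.idxVar 5 = (x : ℕ)) (hy : s.idxVar 6 = (y : ℕ)) :
    IsMaxStep {c | G.Adj x y ∧ (c.1 = |colouring n s x - colouring n s y| ∨
      c.1 = |firstOutput n s x - firstOutput n s y|) ∧ countDiff G s c.1 ≠ 0 ∧
      c.2 = countDiff G s c.1} (topTone s) (topTone (compareStep.run s)) := by
  rw [compareStep, run_ite]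
  have hadj := holds_adjTest hG hx hy
  split_ifs with h
  · set s₁ := s.setR 5 |colouring n s x - colouring n s y| with hs₁
    set s₂ := check.run s₁ with hs₂
    have hf := frame_run check s₁
    rw [← hs₂] at hf
    have hr₂ : s₂.realArr = s.realArr :=
      funext fun a => hf.realArr a (by simp [check, count, countStep, absSub])
    have hx₂ : s₂.idxVar 5 = (x : ℕ) :=
      (hf.idxVar 5 (by simp [check, count, countStep, absSub])).trans hx
    have hy₂ : s₂.idxVar 6 = (y : ℕ) :=
      (hf.idxVar 6 (by simp [check, count, countStep, absSub])).trans hy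
    set s₃ := s₂.setR 5 |firstOutput n s x - firstOutput n s y| with hs₃
    have hG₁ : HasGraph G s₁ := hG.of_eq rfl rfl
    have hG₂ : HasGraph G s₂ := hG₁.of_frame hf (by simp [check, count, countStep, absSub])
      (by simp [check, count, countStep, absSub])
    have hG₃ : HasGraph G s₃ := hG₂.of_eq rfl rfl
    have hrun : ((absSub 5 (newAt 5) (newAt 6) ;; check) ;;
        absSub 5 (bestAt 5) (bestAt 6) ;; check).run s = check.run s₃ := by
      simp only [run_seq, run_absSub, newAt, bestAt, RealExpr.eval, IdxExpr.eval, hx, hy]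
      change check.run (s₂.setR 5 |s₂.realArr 1 0 (s₂.idxVar 5) - s₂.realArr 1 0 (s₂.idxVar 6)|) = _
      rw [hx₂, hy₂, hr₂]
      rfl
    have h1 := run_check s₁ hG₁
    have h2 := run_check s₃ hG₃
    have ht₁ : topTone s₁ = topTone s := by simp [topTone, hs₁]
    have ht₃ : topTone s₃ = topTone s₂ := by simp [topTone, hs₃]
    have hd₁ : countDiff G s₁ = countDiff G s := countDiff_congr rfl
    have hd₃ : countDiff G s₃ = countDiff G s := countDiff_congr hr₂
    have h5₁ : s₁.realVar 5 = |colouring n s x - colouring n s y| := by simp [hs₁]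
    have h5₃ : s₃.realVar 5 = |firstOutput n s x - firstOutput n s y| := by simp [hs₃]
    rw [← hs₂, ht₁, hd₁, h5₁] at h1
    rw [ht₃, hd₃, h5₃] at h2
    rw [hrun]
    refine h1.trans h2 fun c => ?_
    constructor
    · rintro ⟨-, hc | hc, hne, hc2⟩
      · rw [hc] at hne hc2
        exact Or.inl ⟨hne, Prod.ext hc hc2⟩
      · rw [hc] at hne hc2
        exact Or.inr ⟨hne, Prod.ext hc hc2⟩
    · rintro (⟨hne, rfl⟩ | ⟨hne, rfl⟩)
      · exact ⟨hadj.1 h, Or.inl rfl, hne, rfl⟩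
      · exact ⟨hadj.1 h, Or.inr rfl, hne, rfl⟩
  · exact .refl fun c hc => absurd (hadj.2 hc.1) h

theorem run_compare (s : State) (hG : HasGraph G s) :
    IsMaxStep {c | ∃ x y, G.Adj x y ∧ (c.1 = |colouring n s x - colouring n s y| ∨
      c.1 = |firstOutput n s x - firstOutput n s y|) ∧ countDiff G s c.1 ≠ 0 ∧
      c.2 = countDiff G s c.1} (-1, 0) (topTone (compare.run s)) := by
  set S : Fin n → Fin n → Set (ℝ × ℝ) := fun x y =>
    {c | G.Adj x y ∧ (c.1 = |colouring n s x - colouring n s y| ∨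
      c.1 = |firstOutput n s x - firstOutput n s y|) ∧ countDiff G s c.1 ≠ 0 ∧
      c.2 = countDiff G s c.1} with hS
  set s₁ := (s.setR 7 (-1)).setR 8 0 with hs₁
  have hrun : compare.run s = (forN 5 (forN 6 compareStep)).run s₁ := by
    simp [compare, run_seq, run_setReal, eval_negOne, RealExpr.eval, hs₁]
  have ht : topTone s₁ = (-1, 0) := by simp [topTone, hs₁]
  rw [hrun, ← ht]
  have hG₁ : HasGraph G s₁ := hG.of_eq rfl rfl
  have key := isMaxStep_forN topTone (fun i => {c | ∃ x : Fin n, (x : ℕ) = i ∧ ∃ y, c ∈ S x y})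
    (i := 5) (p := forN 6 compareStep) s₁ (fun _ _ => rfl) ?_
  · have : {c | ∃ x y, c ∈ S x y} =
        {c | ∃ i < s₁.idxVar 0, c ∈ {c | ∃ x : Fin n, (x : ℕ) = i ∧ ∃ y, c ∈ S x y}} := by
      rw [hG₁.size]
      ext c
      constructor
      · rintro ⟨x, hx⟩
        exact ⟨x, x.2, x, rfl, hx⟩
      · rintro ⟨m, -, x, -, hx⟩
        exact ⟨x, hx⟩
    exact this ▸ key
  intro i t hi hi' hf
  obtain ⟨x, rfl⟩ : ∃ x : Fin n, (x : ℕ) = i := ⟨⟨i, hG₁.size ▸ hi⟩, rfl⟩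
  have hGt : HasGraph G t := hG₁.of_frame hf
    (by simp [compareStep, check, count, countStep, absSub])
    (by simp [compareStep, check, count, countStep, absSub])
  have hrt : t.realArr = s.realArr :=
    funext fun a => hf.realArr a (by simp [compareStep, check, count, countStep, absSub])
  have key := isMaxStep_forN topTone (fun j => {c | ∃ y : Fin n, (y : ℕ) = j ∧ c ∈ S x y})
    (i := 6) (p := compareStep) t (fun _ _ => rfl) ?_
  · have : {c | ∃ x' : Fin n, (x' : ℕ) = x ∧ ∃ y, c ∈ S x' y} =
        {c | ∃ j < t.idxVar 0, c ∈ {c | ∃ y : Fin n, (y : ℕ) = j ∧ c ∈ S x y}} := by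
      rw [hGt.size]
      ext c
      constructor
      · rintro ⟨x', hx', y, hy⟩
        rw [Fin.val_inj.1 hx'] at hy
        exact ⟨y, y.2, y, rfl, hy⟩
      · rintro ⟨m, -, y, -, hy⟩
        exact ⟨x, rfl, y, hy⟩
    exact this ▸ key
  intro j u hj hj' hfu
  obtain ⟨y, rfl⟩ : ∃ y : Fin n, (y : ℕ) = j := ⟨⟨j, hGt.size ▸ hj⟩, rfl⟩
  have hGu : HasGraph G u := hGt.of_frame hfu
    (by simp [compareStep, check, count, countStep, absSub])
    (by simp [compareStep, check, count, countStep, absSub])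
  have hru : u.realArr = s.realArr :=
    (funext fun a =>
      hfu.realArr a (by simp [compareStep, check, count, countStep, absSub])).trans hrt
  have hx : u.idxVar 5 = (x : ℕ) :=
    (hfu.idxVar 5 (by simp [compareStep, check, count, countStep, absSub])).trans hi'
  have h1 := run_compareStep u hGu hx hj'
  rw [countDiff_congr hru] at h1
  simp only [colouring, firstOutput, hru] at h1
  have : {c | ∃ y' : Fin n, (y' : ℕ) = y ∧ c ∈ S x y'} = S x y := by
    ext c
    constructor
    · rintro ⟨y', hy', h⟩
      rwa [Fin.val_inj.1 hy'] at h
    · exact fun h => ⟨y, rfl, h⟩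
  rw [this]
  exact h1

/-- A tone with different multiplicities occurs on an edge in one of the colourings, so it is among
the tones tested. The highest such tone decides the lexicographic order. -/
theorem gradation_of_compare (s : State) (hG : HasGraph G s) :
    ((compare.run s).realVar 8 = 0 →
      gradation G (colouring n s) = gradation G (firstOutput n s)) ∧
    ((compare.run s).realVar 8 < 0 →
      gradation G (colouring n s) < gradation G (firstOutput n s)) ∧
    (0 < (compare.run s).realVar 8 →
      gradation G (firstOutput n s) < gradation G (colouring n s)) := by
  have h := run_compare s hG
  have hmem : ∀ τ, countDiff G s τ ≠ 0 → 0 ≤ τ ∧ τ ≤ (topTone (compare.run s)).1 := by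
    intro τ hτ
    have : ∃ x y, G.Adj x y ∧ (τ = |colouring n s x - colouring n s y| ∨
        τ = |firstOutput n s x - firstOutput n s y|) := by
      by_cases h1 : Greyscale.toneCount G (colouring n s) τ = 0
      · by_cases h2 : Greyscale.toneCount G (firstOutput n s) τ = 0
        · exact absurd (by rw [countDiff, h1, h2, sub_self]) hτ
        · obtain ⟨x, y, hxy, h⟩ := Greyscale.exists_of_toneCount_ne_zero h2
          exact ⟨x, y, hxy, Or.inr h.symm⟩
      · obtain ⟨x, y, hxy, h⟩ := Greyscale.exists_of_toneCount_ne_zero h1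
        exact ⟨x, y, hxy, Or.inl h.symm⟩
    obtain ⟨x, y, hxy, hτ'⟩ := this
    refine ⟨?_, h.ub (τ, countDiff G s τ) ⟨x, y, hxy, hτ', hτ, rfl⟩⟩
    rcases hτ' with h | h <;> exact h ▸ abs_nonneg _
  -- If the initial value `-1` survives, no tone has different multiplicities, since tones are
  -- nonnegative.
  rcases h.mem with h0 | ⟨x, y, -, -, hne, h2⟩
  · have h8 : (compare.run s).realVar 8 = 0 := congrArg Prod.snd h0
    have h7 : (topTone (compare.run s)).1 = -1 := congrArg Prod.fst h0
    rw [h8]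
    refine ⟨fun _ => Greyscale.gradation_eq_of_toneCount G fun τ => ?_,
      fun h => absurd h (lt_irrefl _), fun h => absurd h (lt_irrefl _)⟩
    by_contra hτ
    have := hmem τ (sub_ne_zero.2 (by exact_mod_cast hτ))
    linarith
  · set t := (topTone (compare.run s)).1
    have h8 : (compare.run s).realVar 8 = countDiff G s t := h2
    have heq : ∀ τ, t < τ → Greyscale.toneCount G (colouring n s) τ =
        Greyscale.toneCount G (firstOutput n s) τ := by
      intro τ hτ
      by_contra hne
      exact absurd (hmem τ (sub_ne_zero.2 (by exact_mod_cast hne))).2 (not_le.2 hτ)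
    rw [h8]
    refine ⟨fun h => absurd h hne, fun h => ?_, fun h => ?_⟩
    · refine Greyscale.gradation_lt_of_toneCount G (t := t) ?_ heq
      rw [countDiff, sub_neg] at h
      exact_mod_cast h
    · refine Greyscale.gradation_lt_of_toneCount G (t := t) ?_ fun τ hτ => (heq τ hτ).symm
      rw [countDiff, sub_pos] at h
      exact_mod_cast h

/-! ## The list of the best colourings -/

/-- Append the new colouring to the list. -/
def append : Code :=
  forN 5 (storeReal 1 (.var 1) (.var 5) (newAt 5)) ;; setIdx 1 (.add (.var 1) (.lit 1))

/-- Update the list with the new colouring. -/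
def updateList : Code :=
  -- An empty list counts as a tie, which forces appending. A negative difference means that the new
  -- colouring is better: the list is emptied first.
  ite (.idxLe (.var 1) (.lit 0)) (setReal 8 (.lit 0)) compare ;;
    ite (.realLe (.lit 0) (.var 8)) skip (setIdx 1 (.lit 0)) ;;
    ite (.realLe (.var 8) (.lit 0)) append skip

theorem run_append (s : State) (hn : s.idxVar 0 = n) :
    (append.run s).idxVar 1 = s.idxVar 1 + 1 ∧
      output n (append.run s) = insert (colouring n s) (output n s) := by
  set p : Code := storeReal 1 (.var 1) (.var 5) (newAt 5) with hp
  have hf := frame_run (forN 5 p) s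
  set s₁ := (forN 5 p).run s with hs₁
  have hrun : append.run s = s₁.setI 1 (s₁.idxVar 1 + 1) := by
    simp only [append, run_seq, run_setIdx, IdxExpr.eval, hs₁, hp]
  have h1 : s₁.idxVar 1 = s.idxVar 1 := hf.idxVar 1 (by simp [hp])
  have key := run_forN_induction (i := 5) (p := p) (fun m t =>
    (∀ k ≠ s.idxVar 1, t.realArr 1 k = s.realArr 1 k) ∧
      ∀ x : Fin n, (x : ℕ) < m → t.realArr 1 (s.idxVar 1) x = colouring n s x) s (by simp) ?_
  · rw [← hs₁, hn] at key
    have hk : (append.run s).idxVar 1 = s.idxVar 1 + 1 := by rw [hrun, h1]; simp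
    refine ⟨hk, ?_⟩
    have hr : (append.run s).realArr = s₁.realArr := by rw [hrun]; rfl
    ext f
    simp only [output, Set.mem_ofPred_eq, Set.mem_insert_iff, hk, hr]
    constructor
    · rintro ⟨k, hk, hfk⟩
      by_cases hk' : k = s.idxVar 1
      · left
        funext i
        rw [hfk i, hk', key.2 i i.2]
      · right
        exact ⟨k, by omega, fun i => by rw [hfk i, key.1 k hk']⟩
    · rintro (rfl | ⟨k, hk, hfk⟩)
      · exact ⟨s.idxVar 1, by omega, fun i => (key.2 i i.2).symm⟩
      · exact ⟨k, by omega, fun i => by rw [hfk i, key.1 k (by omega)]⟩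
  · rintro m t hm hi hft ⟨ih, ih'⟩
    have h1 : t.idxVar 1 = s.idxVar 1 := hft.idxVar 1 (by simp [hp])
    have h2 : t.realArr 2 = s.realArr 2 := hft.realArr 2 (by simp [hp])
    constructor
    · intro k hk
      rw [← ih k hk]
      funext x
      simp [hp, run_storeReal, IdxExpr.eval, h1, hk]
    · intro x hx
      by_cases hxm : (x : ℕ) = m
      · simp [hp, run_storeReal, IdxExpr.eval, RealExpr.eval, newAt, h1, hi, hxm, h2, colouring]
      · simpa [hp, run_storeReal, IdxExpr.eval, RealExpr.eval, newAt, h1, hi, hxm]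
          using ih' x (by omega)

theorem output_congr {s t : State} (h : t.idxVar 1 = s.idxVar 1)
    (h' : t.realArr 1 = s.realArr 1) : output n t = output n s := by
  unfold output
  rw [h, h']

theorem output_eq_empty {s : State} (h : s.idxVar 1 = 0) : output n s = ∅ := by
  ext f
  simp [output, h]

theorem run_updateList (s : State) (hG : HasGraph G s) :
    (updateList.run s).idxVar 1 ≠ 0 ∧
    (s.idxVar 1 = 0 → output n (updateList.run s) = {colouring n s}) ∧
    (s.idxVar 1 ≠ 0 →
      (gradation G (colouring n s) < gradation G (firstOutput n s) →
        output n (updateList.run s) = {colouring n s}) ∧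
      (gradation G (colouring n s) = gradation G (firstOutput n s) →
        output n (updateList.run s) = insert (colouring n s) (output n s)) ∧
      (gradation G (firstOutput n s) < gradation G (colouring n s) →
        output n (updateList.run s) = output n s)) := by
  set p : Code := ite (.idxLe (.var 1) (.lit 0)) (setReal 8 (.lit 0)) compare with hp
  have hf := frame_run p s
  set s₁ := p.run s with hs₁
  have h1 : s₁.idxVar 1 = s.idxVar 1 :=
    hf.idxVar 1 (by simp [hp, compare, compareStep, check, count, countStep, absSub])
  have h0 : s₁.idxVar 0 = n :=
    (hf.idxVar 0 (by simp [hp, compare, compareStep, check, count, countStep, absSub])).trans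
      hG.size
  have hr : s₁.realArr = s.realArr := funext fun a =>
    hf.realArr a (by simp [hp, compare, compareStep, check, count, countStep, absSub])
  have hout : output n s₁ = output n s := output_congr h1 (by rw [hr])
  have hcol : colouring n s₁ = colouring n s := by unfold colouring; rw [hr]
  have hrun : updateList.run s = (ite (.realLe (.var 8) (.lit 0)) append skip).run
      ((ite (.realLe (.lit 0) (.var 8)) skip (setIdx 1 (.lit 0))).run s₁) := rfl
  have hlt : s₁.realVar 8 < 0 →
      (ite (.realLe (.lit 0) (.var 8)) skip (setIdx 1 (.lit 0))).run s₁ = s₁.setI 1 0 := by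
    intro h
    rw [run_ite, if_neg (by simpa [Test.Holds, RealExpr.eval] using h)]
    rfl
  have hge : 0 ≤ s₁.realVar 8 →
      (ite (.realLe (.lit 0) (.var 8)) skip (setIdx 1 (.lit 0))).run s₁ = s₁ := by
    intro h
    rw [run_ite, if_pos (by simpa [Test.Holds, RealExpr.eval] using h)]
    rfl
  have hneg : s₁.realVar 8 < 0 → updateList.run s = append.run (s₁.setI 1 0) := by
    intro h
    rw [hrun, hlt h, run_ite, if_pos (by simpa [Test.Holds, RealExpr.eval] using h.le)]
  have hzero : s₁.realVar 8 = 0 → updateList.run s = append.run s₁ := by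
    intro h
    rw [hrun, hge h.ge, run_ite, if_pos (by simpa [Test.Holds, RealExpr.eval] using h.le)]
  have hpos : 0 < s₁.realVar 8 → updateList.run s = s₁ := by
    intro h
    rw [hrun, hge h.le, run_ite, if_neg (by simpa [Test.Holds, RealExpr.eval] using h)]
    rfl
  have happ := run_append s₁ h0
  have happ' := run_append (s₁.setI 1 0) (n := n) h0
  rw [hcol, hout] at happ
  have hcol' : colouring n (s₁.setI 1 0) = colouring n s := hcol
  rw [hcol', output_eq_empty (n := n) (s := s₁.setI 1 0) (by simp), insert_empty_eq] at happ'
  by_cases hk : s.idxVar 1 = 0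
  · have hz : s₁.realVar 8 = 0 := by
      rw [hs₁, hp, run_ite, if_pos (by simp [Test.Holds, IdxExpr.eval, hk])]
      simp [run_setReal, RealExpr.eval]
    rw [hzero hz, happ.1, happ.2]
    refine ⟨by omega, fun _ => ?_, fun h => absurd hk h⟩
    rw [output_eq_empty hk, insert_empty_eq]
  · have hs₁' : s₁ = compare.run s := by
      rw [hs₁, hp, run_ite, if_neg (by simp [Test.Holds, IdxExpr.eval, hk])]
    obtain ⟨g1, g2, g3⟩ := gradation_of_compare s hG
    rw [← hs₁'] at g1 g2 g3
    rcases lt_trichotomy (s₁.realVar 8) 0 with h | h | h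
    · rw [hneg h, happ'.1, happ'.2]
      have g := g2 h
      exact ⟨by omega, fun h => absurd h hk, fun _ => ⟨fun _ => rfl,
        fun g' => absurd g' g.ne, fun g' => absurd g' g.asymm⟩⟩
    · rw [hzero h, happ.1, happ.2]
      have g := g1 h
      exact ⟨by omega, fun h => absurd h hk, fun _ => ⟨fun g' => absurd g g'.ne,
        fun _ => rfl, fun g' => absurd g g'.ne'⟩⟩
    · rw [hpos h, h1, hout]
      have g := g3 h
      exact ⟨hk, fun h => absurd h hk, fun _ => ⟨fun g' => absurd g' g.asymm,
        fun g' => absurd g' g.ne', fun _ => rfl⟩⟩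

end Code

end RealRAM

namespace Greyscale

/-! ## Incomplete greyscales with one extreme tone -/

section

variable {V : Type*} {g : V → Option ℝ} {a c : ℝ}

/-- The default tone 0 of `getD` is never used: outside the domain of `g` only `w` is read, and its
tone has been replaced by `c`. -/
theorem forall_mem_insert_iff [DecidableEq V] {w : V} (hw : g w = none) {f : V → ℝ} :
    (∀ v ∈ insert w {v | g v ≠ none}, f v = Function.update (fun v => (g v).getD 0) w c v) ↔
      (∀ v x, g v = some x → f v = x) ∧ f w = c := by
  constructor
  · intro h
    refine ⟨fun v x hv => ?_, ?_⟩
    · have hvw : v ≠ w := by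
        rintro rfl
        simp [hw] at hv
      rw [h v (Set.mem_insert_of_mem _ (by simp [hv])), Function.update_of_ne hvw, hv]
      rfl
    · rw [h w (Set.mem_insert _ _), Function.update_self]
  · rintro ⟨h, hc⟩ v hv
    by_cases hvw : v = w
    · rw [hvw, Function.update_self, hc]
    · rw [Function.update_of_ne hvw]
      obtain ⟨x, hx⟩ := Option.ne_none_iff_exists'.1 (Set.mem_of_mem_insert_of_ne hv hvw)
      rw [h v x hx, hx]
      rfl

/-- A greyscale attains both extreme tones, and no vertex coloured by `g` supplies `c`. -/
theorem exists_eq_of_mem_compatibleGreyscales (hac : a = 0 ∧ c = 1 ∨ a = 1 ∧ c = 0)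
    (hc : ¬ ∃ v, g v = some c) {f : V → ℝ} (hf : f ∈ compatibleGreyscales g) :
    ∃ w, g w = none ∧ f w = c := by
  have : ∃ w, f w = c := by
    rcases hac with ⟨-, rfl⟩ | ⟨-, rfl⟩
    · exact hf.1.2.2
    · exact hf.1.2.1
  obtain ⟨w, hw⟩ := this
  refine ⟨w, ?_, hw⟩
  by_contra h
  obtain ⟨x, hx⟩ := Option.ne_none_iff_exists'.1 h
  exact hc ⟨w, by rw [hx, ← hw, hf.2 w x hx]⟩

variable [Fintype V] [DecidableEq V] {G : SimpleGraph V} (hG : G.Connected)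

/-- The best extension of the incomplete colouring `g` in which `w` has the tone `c`. -/
noncomputable def solution (g : V → Option ℝ) (c : ℝ) (w : V) : V → ℝ :=
  bestExt hG (Set.insert_nonempty w {v | g v ≠ none})
    (Function.update (fun v => (g v).getD 0) w c)

/-- One extreme tone comes from `g`, the other from `w`, and best extensions do not leave `[0,1]`.
-/
theorem solution_mem (hg : IsIncompleteGreyscale g) (hac : a = 0 ∧ c = 1 ∨ a = 1 ∧ c = 0)
    (ha : ∃ v, g v = some a) {w : V} (hw : g w = none) :
    solution hG g c w ∈ compatibleGreyscales g ∧ solution hG g c w w = c := by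
  obtain ⟨h1, h2⟩ := (forall_mem_insert_iff (c := c) hw).1
    fun v hv => bestExt_eq hG (Set.insert_nonempty w {v | g v ≠ none})
      (f := Function.update (fun v => (g v).getD 0) w c) hv
  obtain ⟨v, hv⟩ := ha
  have h3 : solution hG g c w v = a := h1 v a hv
  refine ⟨⟨⟨bestExt_mem_Icc hG _ fun z hz => ?_, ?_⟩, h1⟩, h2⟩
  · by_cases hzw : z = w
    · rw [hzw, Function.update_self]
      rcases hac with ⟨-, rfl⟩ | ⟨-, rfl⟩ <;> simp
    · rw [Function.update_of_ne hzw]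
      obtain ⟨x, hx⟩ := Option.ne_none_iff_exists'.1 (Set.mem_of_mem_insert_of_ne hz hzw)
      rw [hx]
      exact hg.2.2 z x hx
  · rcases hac with ⟨rfl, rfl⟩ | ⟨rfl, rfl⟩
    · exact ⟨⟨v, h3⟩, w, h2⟩
    · exact ⟨⟨w, h2⟩, v, h3⟩

theorem gradation_solution_le {w : V} (hw : g w = none) {f : V → ℝ}
    (hf : f ∈ compatibleGreyscales g) (hfw : f w = c) :
    gradation G (solution hG g c w) ≤ gradation G f :=
  gradation_bestExt_le hG _ ((forall_mem_insert_iff hw).2 ⟨hf.2, hfw⟩)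

theorem eq_solution {w : V} (hw : g w = none) {f : V → ℝ} (hf : f ∈ compatibleGreyscales g)
    (hfw : f w = c) (hle : gradation G f ≤ gradation G (solution hG g c w)) :
    f = solution hG g c w :=
  eq_bestExt hG _ ((forall_mem_insert_iff hw).2 ⟨hf.2, hfw⟩) hle

theorem isMinGradation_iff_eq_solution (hg : IsIncompleteGreyscale g)
    (hac : a = 0 ∧ c = 1 ∨ a = 1 ∧ c = 0) (ha : ∃ v, g v = some a) {w : V} (hw : g w = none)
    (f : V → ℝ) : IsMinGradation G {f | f ∈ compatibleGreyscales g ∧ f w = c} f ↔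
      f = solution hG g c w := by
  constructor
  · rintro ⟨⟨hf, hfw⟩, hmin⟩
    exact eq_solution hG hw hf hfw (hmin _ (solution_mem hG hg hac ha hw))
  · rintro rfl
    exact ⟨solution_mem hG hg hac ha hw, fun f' hf' => gradation_solution_le hG hw hf'.1 hf'.2⟩

/-- A global minimum is also minimal among the greyscales with tone `c` at its own vertex `w`, hence
equals the solution for `w`. -/
theorem isMinGradation_iff_exists_solution (hg : IsIncompleteGreyscale g)
    (hac : a = 0 ∧ c = 1 ∨ a = 1 ∧ c = 0) (ha : ∃ v, g v = some a)
    (hc : ¬ ∃ v, g v = some c) (f : V → ℝ) :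
    IsMinGradation G (compatibleGreyscales g) f ↔
      ∃ w, g w = none ∧ f = solution hG g c w ∧
        ∀ w', g w' = none → gradation G (solution hG g c w) ≤ gradation G (solution hG g c w') := by
  constructor
  · rintro ⟨hf, hmin⟩
    obtain ⟨w, hw, hfw⟩ := exists_eq_of_mem_compatibleGreyscales hac hc hf
    have heq := eq_solution hG hw hf hfw (hmin _ (solution_mem hG hg hac ha hw).1)
    refine ⟨w, hw, heq, fun w' hw' => ?_⟩
    rw [← heq]
    exact hmin _ (solution_mem hG hg hac ha hw').1
  · rintro ⟨w, hw, rfl, hmin⟩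
    refine ⟨(solution_mem hG hg hac ha hw).1, fun f' hf' => ?_⟩
    obtain ⟨w', hw', hfw'⟩ := exists_eq_of_mem_compatibleGreyscales hac hc hf'
    exact (hmin w' hw').trans (gradation_solution_le hG hw' hf' hfw')

end

end Greyscale

namespace RealRAM

namespace Code

/-! ## The program -/

/-- Find the missing extreme tone. -/
def detect : Code :=
  -- Tones are nonnegative, so `≤ 0` recognizes the tone 0, and then 1 is missing; otherwise the
  -- initial memory content 0 is the missing tone.
  forN 5 (ite (.and (markTest 1 5) (.realLe (.get 0 (.var 5) (.lit 0)) (.lit 0)))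
    (setReal 0 (.lit 1)) skip)

/-- List the best colourings. -/
def listBest : Code := detect ;; forN 2 (ite (markTest 1 2) skip (solve ;; updateList))

theorem wellFormed_listBest : listBest.WellFormed := by
  simp [listBest, detect, solve, initColouring, round, search, searchStep, table, tableInit,
    tableEntry, maxStep, updateList, append, compare, compareStep, check, count, countStep,
    absSub, WellFormed]

/-- The loop over `w` contains the loop over the rounds, each with three nested loops, and next to
it the four nested loops of the comparison. -/
theorem depth_listBest : listBest.depth = 5 := rfl

variable {n : ℕ} {G : SimpleGraph (Fin n)}

theorem run_detect (s : State) (hn : s.idxVar 0 = n) (h0 : s.realVar 0 = 0) :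
    ((∃ i ∈ inputColoured n s, inputColouring n s i ≤ 0) → (detect.run s).realVar 0 = 1) ∧
      ((¬ ∃ i ∈ inputColoured n s, inputColouring n s i ≤ 0) → (detect.run s).realVar 0 = 0) := by
  set p : Code := ite (.and (markTest 1 5) (.realLe (.get 0 (.var 5) (.lit 0)) (.lit 0)))
    (setReal 0 (.lit 1)) skip with hp
  have key := run_forN_induction (i := 5) (p := p) (fun m t =>
    ((∃ i ∈ inputColoured n s, (i : ℕ) < m ∧ inputColouring n s i ≤ 0) → t.realVar 0 = 1) ∧
      ((¬ ∃ i ∈ inputColoured n s, (i : ℕ) < m ∧ inputColouring n s i ≤ 0) → t.realVar 0 = 0)) s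
    (by simp [h0]) ?_
  · rw [hn] at key
    simpa [detect, hp] using key
  · rintro m t hm hi hf ⟨ih, ih'⟩
    obtain ⟨z, rfl⟩ : ∃ z : Fin n, (z : ℕ) = m := ⟨⟨m, hn ▸ hm⟩, rfl⟩
    have h1 : t.idxArr 1 = s.idxArr 1 := hf.idxArr 1 (by simp [hp])
    have h2 : t.realArr 0 = s.realArr 0 := hf.realArr 0 (by simp [hp])
    have htest : (Test.and (markTest 1 5) (.realLe (.get 0 (.var 5) (.lit 0)) (.lit 0))).Holds t ↔
        z ∈ inputColoured n s ∧ inputColouring n s z ≤ 0 := by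
      simp [Test.Holds, markTest, RealExpr.eval, IdxExpr.eval, hi, h1, h2, inputColoured,
        inputColouring]
    rw [State.setI_realVar, hp, run_ite]
    split_ifs with h
    · refine ⟨fun _ => by simp [run_setReal, RealExpr.eval], fun hn => absurd ?_ hn⟩
      exact ⟨z, (htest.1 h).1, by simp, (htest.1 h).2⟩
    · rw [run_skip]
      have : (∃ i ∈ inputColoured n s, (i : ℕ) < z + 1 ∧ inputColouring n s i ≤ 0) ↔
          ∃ i ∈ inputColoured n s, (i : ℕ) < z ∧ inputColouring n s i ≤ 0 := by
        constructor
        · rintro ⟨i, hi, hlt, hle⟩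
          refine ⟨i, hi, lt_of_le_of_ne (by omega) fun hiz => h (htest.2 ?_), hle⟩
          rw [← Fin.val_inj.1 hiz]
          exact ⟨hi, hle⟩
        · rintro ⟨i, hi, hlt, hle⟩
          exact ⟨i, hi, by omega, hle⟩
      rw [this]
      exact ⟨ih, ih'⟩

theorem firstOutput_mem {s : State} (h : s.idxVar 1 ≠ 0) : firstOutput n s ∈ output n s :=
  ⟨0, Nat.pos_of_ne_zero h, fun _ => rfl⟩

/-- The list contains the best ones among the colourings `F w`, `w ∈ S`. -/
structure ListsBest (G : SimpleGraph (Fin n)) (F : Fin n → Fin n → ℝ) (S : Set (Fin n))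
    (s : State) : Prop where
  output : output n s =
    {f | ∃ w ∈ S, f = F w ∧ ∀ w' ∈ S, gradation G (F w) ≤ gradation G (F w')}
  empty : s.idxVar 1 = 0 → S = ∅

/-- All listed colourings have the same gradation vector, so it suffices to compare with the first
one. Repetitions do not matter, as `output` is a set. -/
theorem ListsBest.insert {F : Fin n → Fin n → ℝ} {S : Set (Fin n)} {s : State}
    (h : ListsBest G F S s) (hG : HasGraph G s) {w : Fin n} (hw : colouring n s = F w) :
    ListsBest G F (insert w S) (updateList.run s) := by
  obtain ⟨h0, h1, h2⟩ := run_updateList s hG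
  refine ⟨?_, fun h => absurd h h0⟩
  rw [hw] at h1 h2
  by_cases hk : s.idxVar 1 = 0
  · rw [h1 hk, h.empty hk]
    ext f
    simp
  · obtain ⟨g1, g2, g3⟩ := h2 hk
    have hb := firstOutput_mem (n := n) hk
    rw [h.output] at hb
    obtain ⟨b, hbS, hbF, hmin⟩ := hb
    rw [hbF] at g1 g2 g3
    rcases lt_trichotomy (gradation G (F w)) (gradation G (F b)) with hlt | heq | hlt
    · rw [g1 hlt]
      ext f
      constructor
      · rintro rfl
        refine ⟨w, Set.mem_insert _ _, rfl, fun w' hw' => ?_⟩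
        rcases hw' with rfl | hw'
        · exact le_rfl
        · exact hlt.le.trans (hmin w' hw')
      · rintro ⟨w', hw', rfl, hle⟩
        rcases hw' with rfl | hw'
        · rfl
        · exact absurd ((hmin w' hw').trans (hle w (Set.mem_insert _ _))) (not_le.2 hlt)
    · rw [g2 heq, h.output]
      ext f
      constructor
      · rintro (rfl | ⟨w', hw', rfl, hle⟩)
        · refine ⟨w, Set.mem_insert _ _, rfl, fun w' hw' => ?_⟩
          rcases hw' with rfl | hw'
          · exact le_rfl
          · exact heq.le.trans (hmin w' hw')
        · refine ⟨w', Set.mem_insert_of_mem _ hw', rfl, fun w'' hw'' => ?_⟩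
          rcases hw'' with rfl | hw''
          · exact (hle b hbS).trans heq.ge
          · exact hle w'' hw''
      · rintro ⟨w', hw', rfl, hle⟩
        rcases hw' with rfl | hw'
        · exact Or.inl rfl
        · exact Or.inr ⟨w', hw', rfl, fun w'' hw'' => hle w'' (Set.mem_insert_of_mem _ hw'')⟩
    · rw [g3 hlt, h.output]
      ext f
      constructor
      · rintro ⟨w', hw', rfl, hle⟩
        refine ⟨w', Set.mem_insert_of_mem _ hw', rfl, fun w'' hw'' => ?_⟩
        rcases hw'' with rfl | hw''
        · exact (hle b hbS).trans hlt.le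
        · exact hle w'' hw''
      · rintro ⟨w', hw', rfl, hle⟩
        rcases hw' with rfl | hw'
        · exact absurd (hle b (Set.mem_insert_of_mem _ hbS)) (not_le.2 hlt)
        · exact ⟨w', hw', rfl, fun w'' hw'' => hle w'' (Set.mem_insert_of_mem _ hw'')⟩

/-- The invariant is `ListsBest` for the uncoloured vertices treated so far; `solve` supplies the
next colouring and leaves the list alone. -/
theorem run_mainLoop (hc : G.Connected) (s : State) (hG : HasGraph G s) (h1 : s.idxVar 1 = 0)
    (hc01 : s.realVar 0 ∈ Set.Icc (0 : ℝ) 1)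
    (hf : ∀ v ∈ inputColoured n s, inputColouring n s v ∈ Set.Icc (0 : ℝ) 1) :
    ListsBest G (fun w => Greyscale.bestExt hc (Set.insert_nonempty w (inputColoured n s))
        (Function.update (inputColouring n s) w (s.realVar 0))) (inputColoured n s)ᶜ
      ((forN 2 (ite (markTest 1 2) skip (solve ;; updateList))).run s) := by
  set F : Fin n → Fin n → ℝ := fun w =>
    Greyscale.bestExt hc (Set.insert_nonempty w (inputColoured n s))
        (Function.update (inputColouring n s) w (s.realVar 0)) with hF
  have key := run_forN_induction (i := 2) (p := ite (markTest 1 2) skip (solve ;; updateList))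
    (fun m t => ListsBest G F {w | w ∉ inputColoured n s ∧ (w : ℕ) < m} t) s ?_ ?_
  · rw [hG.size] at key
    simpa [Set.compl_def] using key
  · have : {w : Fin n | w ∉ inputColoured n s ∧ (w : ℕ) < 0} = ∅ := by simp
    rw [this]
    refine ⟨?_, fun _ => rfl⟩
    rw [output_eq_empty (by simpa using h1)]
    simp
  · intro m t hm hi hft ih
    obtain ⟨w, rfl⟩ : ∃ w : Fin n, (w : ℕ) = m := ⟨⟨m, hG.size ▸ hm⟩, rfl⟩
    have hGt : HasGraph G t := hG.of_frame hft
      (by simp [solve, initColouring, round, search, searchStep, table, tableInit,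
        tableEntry, maxStep, updateList, append, compare, compareStep, check, count, countStep,
        absSub])
      (by simp [solve, initColouring, round, search, searchStep, table, tableInit,
        tableEntry, maxStep, updateList, append, compare, compareStep, check, count, countStep,
        absSub])
    have hi1 : t.idxArr 1 = s.idxArr 1 := hft.idxArr 1
      (by simp [solve, initColouring, round, search, searchStep, table, tableInit,
        tableEntry, maxStep, updateList, append, compare, compareStep, check, count, countStep,
        absSub])
    have hr0 : t.realArr 0 = s.realArr 0 := hft.realArr 0
      (by simp [solve, initColouring, round, search, searchStep, table, tableInit,
        tableEntry, maxStep, updateList, append, compare, compareStep, check, count, countStep,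
        absSub])
    have hv0 : t.realVar 0 = s.realVar 0 := hft.realVar 0
      (by simp [solve, initColouring, round, search, searchStep, table, tableInit,
        tableEntry, maxStep, updateList, append, compare, compareStep, check, count, countStep,
        absSub])
    have hIC : inputColoured n t = inputColoured n s := by unfold inputColoured; rw [hi1]
    have hIf : inputColouring n t = inputColouring n s := by unfold inputColouring; rw [hr0]
    have htest : (markTest 1 2).Holds t ↔ w ∈ inputColoured n s := by
      rw [holds_markTest hi, hi1]
      rfl
    have hset : ∀ {u : State} {S : Set (Fin n)}, ListsBest G F S u →
        ListsBest G F S (u.setI 2 (w + 1)) := fun h => ⟨h.output, h.empty⟩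
    apply hset
    rw [run_ite]
    split_ifs with h
    · have : {z : Fin n | z ∉ inputColoured n s ∧ (z : ℕ) < w + 1} =
          {z | z ∉ inputColoured n s ∧ (z : ℕ) < w} := by
        ext z
        refine and_congr_right fun hz => ⟨fun hlt => ?_, fun hlt => by omega⟩
        refine lt_of_le_of_ne (by omega) fun hzw => hz ?_
        rw [Fin.val_inj.1 hzw]
        exact htest.1 h
      rw [this]
      exact ih
    · have : {z : Fin n | z ∉ inputColoured n s ∧ (z : ℕ) < w + 1} =
          insert w {z | z ∉ inputColoured n s ∧ (z : ℕ) < w} := by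
        ext z
        simp only [Set.mem_ofPred_eq, Set.mem_insert_iff, Nat.lt_succ_iff_lt_or_eq, Fin.val_inj]
        constructor
        · rintro ⟨hz, hlt | rfl⟩
          · exact Or.inr ⟨hz, hlt⟩
          · exact Or.inl rfl
        · rintro (rfl | ⟨hz, hlt⟩)
          · exact ⟨fun h' => h (htest.2 h'), Or.inr rfl⟩
          · exact ⟨hz, Or.inl hlt⟩
      rw [this, run_seq]
      have hsol := run_solve hc t hGt hi (hv0 ▸ hc01) (by rw [hIC, hIf]; exact hf)
      have hfs := frame_run solve t
      have hsolF : colouring n (solve.run t) = F w := by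
        rw [hsol, hF]
        congr 1
        · rw [hIC]
        · rw [hIf, hv0]
      refine ListsBest.insert ⟨?_, ?_⟩ (hGt.of_frame hfs ?_ ?_) hsolF
      · rw [← ih.output]
        exact output_congr (hfs.idxVar 1 (by simp [solve, initColouring, round, search, searchStep,
          table, tableInit, tableEntry, maxStep])) (hfs.realArr 1 (by simp [solve, initColouring,
          round, search, searchStep, table, tableInit, tableEntry, maxStep]))
      · rw [hfs.idxVar 1 (by simp [solve, initColouring, round, search, searchStep,
          table, tableInit, tableEntry, maxStep])]
        exact ih.empty
      · simp [solve, initColouring, round, search, searchStep, table, tableInit, tableEntry, maxStep]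
      · simp [solve, initColouring, round, search, searchStep, table, tableInit, tableEntry, maxStep]

end Code

/-! ### Correctness on the encoded input -/

theorem hasGraph_input {n : ℕ} (G : SimpleGraph (Fin n)) (g : Fin n → Option ℝ) :
    HasGraph G (input G g) := by
  refine ⟨rfl, fun i j => ?_⟩
  simp only [input, if_true]
  by_cases h : G.Adj i j
  · simp [h]
  · simp [h]

theorem inputColoured_input {n : ℕ} (G : SimpleGraph (Fin n)) (g : Fin n → Option ℝ) :
    Code.inputColoured n (input G g) = {v | g v ≠ none} := by
  ext v
  by_cases h : g v = none <;> simp [Code.inputColoured, input, h]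

theorem inputColouring_input {n : ℕ} (G : SimpleGraph (Fin n)) (g : Fin n → Option ℝ) :
    Code.inputColouring n (input G g) = fun v => (g v).getD 0 := by
  funext v
  simp [Code.inputColouring, input]

theorem output_run_listBest {n : ℕ} (G : SimpleGraph (Fin n)) (g : Fin n → Option ℝ)
    (hc : G.Connected) (hg : IsIncompleteGreyscale g)
    (hx : Xor (∃ v, g v = some 0) (∃ v, g v = some 1)) :
    output n (Code.listBest.run (input G g)) =
      {f | IsMinGradation G (compatibleGreyscales g) f} := by
  have hG := hasGraph_input G g
  have hD := inputColoured_input G g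
  have hF := inputColouring_input G g
  have hdet := Code.run_detect (input G g) hG.size rfl
  have hf := Code.frame_run Code.detect (input G g)
  rw [hD, hF] at hdet
  set s := Code.detect.run (input G g) with hs
  have hD' : Code.inputColoured n s = {v | g v ≠ none} := by
    rw [← hD]
    unfold Code.inputColoured
    rw [hf.idxArr 1 (by simp [Code.detect])]
  have hF' : Code.inputColouring n s = fun v => (g v).getD 0 := by
    rw [← hF]
    unfold Code.inputColouring
    rw [hf.realArr 0 (by simp [Code.detect])]
  have hGs : HasGraph G s := hG.of_frame hf (by simp [Code.detect]) (by simp [Code.detect])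
  have hcnt : s.idxVar 1 = 0 := hf.idxVar 1 (by simp [Code.detect])
  -- The detected tone is the one that `g` does not attain; `a` is the one that it does attain.
  obtain ⟨a, hac, ha, hc'⟩ : ∃ a, (a = 0 ∧ s.realVar 0 = 1 ∨ a = 1 ∧ s.realVar 0 = 0) ∧
      (∃ v, g v = some a) ∧ ¬ ∃ v, g v = some (s.realVar 0) := by
    rcases hx with ⟨⟨v, hv⟩, h1⟩ | ⟨h1, h0⟩
    · have : s.realVar 0 = 1 := hdet.1 ⟨v, by simp [hv], by simp [hv]⟩
      rw [this]
      exact ⟨0, Or.inl ⟨rfl, rfl⟩, ⟨v, hv⟩, h1⟩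
    · have : s.realVar 0 = 0 := by
        refine hdet.2 ?_
        rintro ⟨v, hv, hle⟩
        obtain ⟨x, hx⟩ := Option.ne_none_iff_exists'.1 hv
        simp only [hx, Option.getD_some] at hle
        exact h0 ⟨v, by rw [hx, le_antisymm hle (hg.2.2 v x hx).1]⟩
      rw [this]
      exact ⟨1, Or.inr ⟨rfl, rfl⟩, h1, h0⟩
  have key := Code.run_mainLoop hc s hGs hcnt
    (by rcases hac with ⟨-, h⟩ | ⟨-, h⟩ <;> simp [h]) (by
      rw [hD', hF']
      intro v hv
      obtain ⟨x, hx⟩ := Option.ne_none_iff_exists'.1 hv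
      simp only [hx]
      exact hg.2.2 v x hx)
  have hout := key.output
  change output n (Code.listBest.run (input G g)) = _ at hout
  have hsol : ∀ w, Greyscale.bestExt hc (Set.insert_nonempty w (Code.inputColoured n s))
      (Function.update (Code.inputColouring n s) w (s.realVar 0)) =
        Greyscale.solution hc g (s.realVar 0) w := by
    intro w
    rw [Greyscale.solution]
    congr 1
    · rw [hD']
    · rw [hF']
  rw [hout]
  ext f
  simp only [Set.mem_ofPred_eq]
  rw [Greyscale.isMinGradation_iff_exists_solution hc hg hac ha hc' f]
  simp only [hsol, hD', Set.mem_compl_iff, Set.mem_ofPred_eq, not_not]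

end RealRAM

theorem mainTheorem3 :
    -- one program lists all minimum gradation greyscales, in time `O(n ^ 5)`
    (∃ (P : RealRAM.Program) (C : ℕ), ∀ (n : ℕ) (G : SimpleGraph (Fin n)) (g : Fin n → Option ℝ),
      G.Connected → IsIncompleteGreyscale g →
      Xor (∃ v, g v = some 0) (∃ v, g v = some 1) →
      ∃ (t : ℕ) (s : RealRAM.State), RealRAM.Runs P (RealRAM.input G g) t s ∧
        t ≤ C * n ^ 5 ∧
        RealRAM.output n s = {f | IsMinGradation G (compatibleGreyscales g) f}) ∧
    -- these greyscales are the best ones among the unique solutions that are obtained by giving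
    -- the missing extreme tone `c` to an uncoloured vertex `w`
    (∀ (V : Type*) [Fintype V] (G : SimpleGraph V) (g : V → Option ℝ) (a c : ℝ),
      G.Connected → IsIncompleteGreyscale g →
      (a = 0 ∧ c = 1 ∨ a = 1 ∧ c = 0) →
      (∃ v, g v = some a) → (¬ ∃ v, g v = some c) →
      ∃ F : V → V → ℝ,
        (∀ w, g w = none → ∀ f : V → ℝ,
          IsMinGradation G {f | f ∈ compatibleGreyscales g ∧ f w = c} f ↔ f = F w) ∧
        ∀ f : V → ℝ, IsMinGradation G (compatibleGreyscales g) f ↔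
          ∃ w, g w = none ∧ f = F w ∧
            ∀ w', g w' = none → gradation G (F w) ≤ gradation G (F w')) := by
  refine ⟨?_, ?_⟩
  · obtain ⟨C, hC⟩ := RealRAM.Code.listBest.exists_cost_le
    refine ⟨RealRAM.Code.listBest.toProgram, C, fun n G g hG hg hx => ?_⟩
    obtain ⟨t, ht, hle⟩ := RealRAM.Code.exists_runs RealRAM.Code.wellFormed_listBest
      (RealRAM.input G g)
    -- A coloured vertex exists, so `n` is positive, as the cost bound requires.
    obtain ⟨v, -⟩ := hg.1
    have hn := hC n (Fin.pos v)
    rw [RealRAM.Code.depth_listBest] at hn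
    exact ⟨t, _, ht, hle.trans hn, RealRAM.output_run_listBest G g hG hg hx⟩
  · intro V _ G g a c hG hg hac ha hc
    classical
    exact ⟨Greyscale.solution hG g c,
      fun w hw f => Greyscale.isMinGradation_iff_eq_solution hG hg hac ha hw f,
      fun f => Greyscale.isMinGradation_iff_exists_solution hG hg hac ha hc f⟩
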